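/- Let $a,b\in\mathbb R$ with $b^2>a^2>0$, $\theta\in[0,1]$, $s\ge 0$ and $m\in[1,2)$. Consider in $\mathbb R^3$ the linear Cauchy problem $$u_{tt}-a^2\Delta u-(b^2-a^2)\nabla\operatorname{div}u+(-\Delta)^{\theta}u_t=0\quad (t>0),\qquad (u,u_t)(0,\cdot)=(u_0,u_1),$$ for $u=(u^{(1)},u^{(2)},u^{(3)})$. Here $|D|^{\sigma}$ is the operator with symbol $|\xi|^{\sigma}$ and $(-\Delta)^\theta=|D|^{2\theta}$. Let $\mathcal Z'=\mathcal S'/\mathcal P$ be the space of tempered distributions modulo polynomials, that is, the dual of the space of Schwartz functions $\varphi$ such that $\hat\varphi$ vanishes at $0$ together with all its derivatives. For $f\in\mathcal Z'$ put $\|f\|_{|D|^{-1}H^{s}}=\big(\int|\xi|^2(1+|\xi|^2)^{s}|\hat f(\xi)|^2d\xi\big)^{1/2}$ and $\|f\|_{\dot H^1_m}=\||D|f\|_{L^m}$, and for data $(f,g)\in(|D|^{-1}H^{s}\cap\dot H^1_m)\times(H^{s}\cap L^m)$ put $$\|(f,g)\|_{\mathcal D^{s}_{m,2}}=\|f\|_{|D|^{-1}H^{s}}+\|f\|_{\dot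 H^1_m}+\|g\|_{H^{s}}+\|g\|_{L^m}.$$ Then there is a constant $C>0$, depending only on $a,b,\theta,s,m$, with the following property. Let $(u_0^{(k)},u_1^{(k)})\in\mathcal D^{s}_{m,2}$ for $k=1,2,3$, and let $u\in C([0,\infty),\dot H^1)\cap C^1([0,\infty),L^2)$ (componentwise; in the sense that $|D|u,u_t\in C([0,\infty),L^2)$) be an energy solution of the Cauchy problem. Then, for all $t\ge0$ and $k=1,2,3$, $$\||D|^{s+1}u^{(k)}(t,\cdot)\|_{L^2}+\||D|^{s}u^{(k)}_t(t,\cdot)\|_{L^2}\le C(1+t)^{-\frac{3(2-m)+2ms}{4m\max\{1-\theta,\theta\}}}\sum_{j=1}^3\big\|(u_0^{(j)},u_1^{(j)})\big\|_{\mathcal D^{s}_{m,2}},$$ and, if moreover $m\in[1,6/5)$, $$\|u^{(k)}(t,\cdot)\|_{L^2}\le C(1+t)^{-\frac{6-5m}{4m\max\{1-\theta,\theta\}}}\sum_{j=1}^3\big\|(u_0^{(j)},u_1^{(j)})\big\|_{\mathcal D^{0}_{m,2}}.$$ In particular the norms on the left-hand sides are finite. -/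

import Mathlib

open MeasureTheory LineDeriv
open scoped SchwartzMap ContDiff FourierTransform ENNReal
namespace ElasticWave

/-- Euclidean three-space. -/
abbrev R3 : Type := EuclideanSpace ℝ (Fin 3)

/-! Multiplication by a power of `|ξ|` preserves the Schwartz functions all of whose derivatives
vanish at the origin. -/

namespace Flat
variable {V : Type} [NormedAddCommGroup V] [NormedSpace ℝ V]

theorem bound (F : 𝓢(R3, V)) (hF : ∀ n : ℕ, iteratedFDeriv ℝ n F 0 = 0) (k : ℕ) :
    ∀ (n : ℕ) (ξ : R3), ‖iteratedFDeriv ℝ n F ξ‖ ≤ SchwartzMap.seminorm ℝ 0 (n + k) F * ‖ξ‖ ^ k := by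
  induction k with
  | zero => intro n ξ; simpa using F.norm_iteratedFDeriv_le_seminorm ℝ n ξ
  | succ k ih =>
    intro n ξ
    have hd : Differentiable ℝ (iteratedFDeriv ℝ n F) :=
      (F.smooth ⊤).differentiable_iteratedFDeriv (by exact_mod_cast ENat.natCast_lt_top n)
    have h := (convex_closedBall (0 : R3) ‖ξ‖).norm_image_sub_le_of_norm_fderiv_le (𝕜 := ℝ)
      (f := iteratedFDeriv ℝ n F) (C := SchwartzMap.seminorm ℝ 0 (n + 1 + k) F * ‖ξ‖ ^ k)
      (x := 0) (y := ξ) (fun x _ => hd x) (fun x hx => by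
        rw [norm_fderiv_iteratedFDeriv]
        refine (ih (n + 1) x).trans ?_
        have : ‖x‖ ≤ ‖ξ‖ := by simpa using hx
        have h0 : 0 ≤ SchwartzMap.seminorm ℝ 0 (n + 1 + k) F := apply_nonneg _ _
        gcongr) (by simp) (by simp)
    rw [hF n, sub_zero, sub_zero] at h
    rw [show n + (k + 1) = n + 1 + k by ring, pow_succ, ← mul_assoc]
    exact h

theorem rbound (n : ℕ) (r : ℝ) : ∃ q : Seminorm ℝ 𝓢(R3, V), Continuous q ∧
    ∀ F : 𝓢(R3, V), (∀ n : ℕ, iteratedFDeriv ℝ n F 0 = 0) →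
      ∀ ξ, ‖ξ‖ ^ r * ‖iteratedFDeriv ℝ n F ξ‖ ≤ q F := by
  obtain ⟨K, hK⟩ := exists_nat_ge |r|
  refine ⟨SchwartzMap.seminorm ℝ K n + SchwartzMap.seminorm ℝ 0 (n + K), ?_, ?_⟩
  · exact ((schwartz_withSeminorms ℝ R3 V).continuous_seminorm (K, n)).add
      ((schwartz_withSeminorms ℝ R3 V).continuous_seminorm (0, n + K))
  · intro F hF ξ
    have h1 := F.le_seminorm ℝ K n ξ
    have h2 := bound F hF K n ξ
    have p1 : 0 ≤ SchwartzMap.seminorm ℝ K n F := apply_nonneg _ _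
    have p2 : 0 ≤ SchwartzMap.seminorm ℝ 0 (n + K) F := apply_nonneg _ _
    change _ ≤ SchwartzMap.seminorm ℝ K n F + SchwartzMap.seminorm ℝ 0 (n + K) F
    rcases eq_or_ne ξ 0 with rfl | h0
    · rw [hF n]; simp; positivity
    have hpos : 0 < ‖ξ‖ := norm_pos_iff.2 h0
    rcases le_total 1 ‖ξ‖ with h | h
    · have : ‖ξ‖ ^ r ≤ ‖ξ‖ ^ K := by
        rw [← Real.rpow_natCast]
        exact Real.rpow_le_rpow_of_exponent_le h ((le_abs_self r).trans hK)
      have := mul_le_mul_of_nonneg_right this (norm_nonneg (iteratedFDeriv ℝ n F ξ))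
      linarith
    · have h3 : ‖ξ‖ ^ r ≤ ‖ξ‖ ^ (-(K : ℝ)) :=
        Real.rpow_le_rpow_of_exponent_ge hpos h (by linarith [neg_abs_le r])
      have h4 : ‖ξ‖ ^ r * ‖iteratedFDeriv ℝ n F ξ‖ ≤ ‖ξ‖ ^ (-(K : ℝ)) *
          (SchwartzMap.seminorm ℝ 0 (n + K) F * ‖ξ‖ ^ K) := by gcongr
      have h5 : ‖ξ‖ ^ (-(K : ℝ)) * ‖ξ‖ ^ K = 1 := by
        rw [Real.rpow_neg hpos.le, Real.rpow_natCast]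
        exact inv_mul_cancel₀ (by positivity)
      have h6 : ‖ξ‖ ^ (-(K : ℝ)) * (SchwartzMap.seminorm ℝ 0 (n + K) F * ‖ξ‖ ^ K) =
        SchwartzMap.seminorm ℝ 0 (n + K) F := by
        rw [mul_left_comm, h5, mul_one]
      linarith

theorem fderiv_flat (F : 𝓢(R3, V)) (hF : ∀ n : ℕ, iteratedFDeriv ℝ n F 0 = 0) (n : ℕ) :
    iteratedFDeriv ℝ n (SchwartzMap.fderivCLM ℝ R3 V F) 0 = 0 := by
  have h : ⇑(SchwartzMap.fderivCLM ℝ R3 V F) = fderiv ℝ F := rfl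
  rw [h, ← norm_eq_zero, norm_iteratedFDeriv_fderiv, hF, norm_zero]

/-- Pointwise multiplication by the linear form `σ ⟪ξ, ·⟫`. -/
noncomputable def twist (V : Type) [NormedAddCommGroup V] [NormedSpace ℝ V] (σ : ℝ) :
    𝓢(R3, V) →L[ℝ] 𝓢(R3, R3 →L[ℝ] V) :=
  σ • SchwartzMap.bilinLeftCLM (𝕜 := ℝ) (ContinuousLinearMap.smulRightL ℝ R3 V).flip
    (g := fun ξ : R3 => innerSL ℝ ξ) (innerSL ℝ).hasTemperateGrowth

theorem twist_apply (σ : ℝ) (F : 𝓢(R3, V)) (ξ : R3) :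
    twist V σ F ξ = σ • (innerSL ℝ ξ).smulRight (F ξ) := rfl

theorem twist_flat (σ : ℝ) (F : 𝓢(R3, V)) (hF : ∀ n : ℕ, iteratedFDeriv ℝ n F 0 = 0) (n : ℕ) :
    iteratedFDeriv ℝ n (twist V σ F) 0 = 0 := by
  have h := (ContinuousLinearMap.smulRightL ℝ R3 V).flip.norm_iteratedFDeriv_le_of_bilinear
    (F.smooth ⊤) (innerSL ℝ (E := R3)).contDiff 0 (n := n) (by exact_mod_cast le_top)
  simp only [hF, norm_zero, mul_zero, zero_mul, Finset.sum_const_zero] at h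
  have h' := norm_eq_zero.1 (le_antisymm h (norm_nonneg _))
  have e : ⇑(twist V σ F) = σ • (fun y => (ContinuousLinearMap.smulRightL ℝ R3 V).flip (F y)
      (innerSL ℝ y)) := rfl
  rw [e, iteratedFDeriv_const_smul_apply, h', smul_zero]
  exact (((ContinuousLinearMap.smulRightL ℝ R3 V).flip.isBoundedBilinearMap.contDiff.comp
      ((F.smooth n).prodMk (innerSL ℝ (E := R3)).contDiff)).contDiffAt)

theorem hasFDerivAt_rpow_smul (σ : ℝ) (F : 𝓢(R3, V))
    (hF : ∀ n : ℕ, iteratedFDeriv ℝ n F 0 = 0) (ξ : R3) :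
    HasFDerivAt (fun x => ‖x‖ ^ σ • F x)
      (‖ξ‖ ^ σ • SchwartzMap.fderivCLM ℝ R3 V F ξ + ‖ξ‖ ^ (σ - 2) • twist V σ F ξ) ξ := by
  rcases eq_or_ne ξ 0 with rfl | h0
  · have z0 : F 0 = 0 := by
      have := hF 0
      rw [← norm_eq_zero, norm_iteratedFDeriv_zero, norm_eq_zero] at this
      exact this
    have z1 : SchwartzMap.fderivCLM ℝ R3 V F 0 = 0 := by
      have := fderiv_flat F hF 0
      rwa [← norm_eq_zero, norm_iteratedFDeriv_zero, norm_eq_zero] at this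
    have z2 : twist V σ F 0 = 0 := by
      have := twist_flat σ F hF 0
      rwa [← norm_eq_zero, norm_iteratedFDeriv_zero, norm_eq_zero] at this
    rw [z1, z2, smul_zero, smul_zero, add_zero]
    obtain ⟨q, -, hq⟩ := rbound (V := V) 0 (σ - 2)
    have hq' := hq F hF
    refine HasFDerivAt.of_isLittleO ?_
    simp only [z0, smul_zero, sub_zero, zero_apply]
    have hO : (fun x : R3 => ‖x‖ ^ σ • F x) =O[nhds 0] fun x => ‖x‖ ^ 2 := by
      refine Asymptotics.IsBigO.of_bound (q F) (Filter.Eventually.of_forall fun x => ?_)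
      rcases eq_or_ne x 0 with rfl | hx
      · simp [z0]
      have hpos : 0 < ‖x‖ := norm_pos_iff.2 hx
      have h := hq' x
      rw [norm_iteratedFDeriv_zero] at h
      have e : ‖x‖ ^ σ = ‖x‖ ^ (σ - 2) * ‖x‖ ^ 2 := by
        rw [← Real.rpow_natCast, ← Real.rpow_add hpos]; norm_num
      rw [norm_smul, Real.norm_of_nonneg (by positivity), Real.norm_of_nonneg (by positivity), e]
      nlinarith [sq_nonneg ‖x‖]
    refine hO.trans_isLittleO ?_
    exact Asymptotics.isLittleO_norm_pow_id one_lt_two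
  · have hpos : 0 < ‖ξ‖ := norm_pos_iff.2 h0
    have h1 : HasFDerivAt (fun x : R3 => ‖x‖ ^ σ)
        ((σ * ‖ξ‖ ^ (σ - 2)) • innerSL ℝ ξ) ξ := by
      have h2 := (hasStrictFDerivAt_norm_sq ξ).hasFDerivAt.rpow_const (p := σ / 2)
        (Or.inl (by positivity))
      have e1 : (fun x : R3 => (‖x‖ ^ 2) ^ (σ / 2)) = fun x => ‖x‖ ^ σ := by
        funext x
        rw [← Real.rpow_natCast, ← Real.rpow_mul (norm_nonneg x)]
        congr 1; push_cast; ring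
      rw [e1] at h2
      convert! h2 using 1
      have e2 : (‖ξ‖ ^ 2) ^ (σ / 2 - 1) = ‖ξ‖ ^ (σ - 2) := by
        rw [← Real.rpow_natCast, ← Real.rpow_mul (norm_nonneg ξ)]
        congr 1; push_cast; ring
      rw [e2]
      ext y
      simp
      ring
    have h3 := h1.smul (F.hasFDerivAt ξ)
    convert! h3 using 1
    ext y
    simp [twist_apply, SchwartzMap.fderivCLM_apply]
    module

theorem rpow_smul_bound (n : ℕ) : ∀ (V : Type) [NormedAddCommGroup V] [NormedSpace ℝ V] (σ r : ℝ),
    ∃ q : Seminorm ℝ 𝓢(R3, V), Continuous q ∧ ∀ F : 𝓢(R3, V),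
      (∀ n : ℕ, iteratedFDeriv ℝ n F 0 = 0) →
        ContDiff ℝ n (fun x => ‖x‖ ^ σ • F x) ∧
        ∀ ξ, ‖ξ‖ ^ r * ‖iteratedFDeriv ℝ n (fun x => ‖x‖ ^ σ • F x) ξ‖ ≤ q F := by
  induction n with
  | zero =>
    intro V _ _ σ r
    obtain ⟨q, hqc, hq⟩ := rbound (V := V) 0 (r + σ)
    obtain ⟨q', hqc', hq'⟩ := rbound (V := V) 0 0
    refine ⟨q, hqc, fun F hF => ⟨?_, fun ξ => ?_⟩⟩
    · exact contDiff_zero.2 (continuous_iff_continuousAt.2 fun x =>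
        (hasFDerivAt_rpow_smul σ F hF x).continuousAt)
    · have h := hq F hF ξ
      rw [norm_iteratedFDeriv_zero] at h ⊢
      rcases eq_or_ne ξ 0 with rfl | h0
      · have z0 : F 0 = 0 := by
          have := hF 0
          rwa [← norm_eq_zero, norm_iteratedFDeriv_zero, norm_eq_zero] at this
        simp [z0]
      · rw [norm_smul, Real.norm_of_nonneg (by positivity), ← mul_assoc,
          ← Real.rpow_add (norm_pos_iff.2 h0)]
        exact h
  | succ n ih =>
    intro V _ _ σ r
    obtain ⟨q₁, hc₁, h₁⟩ := ih (R3 →L[ℝ] V) σ r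
    obtain ⟨q₂, hc₂, h₂⟩ := ih (R3 →L[ℝ] V) (σ - 2) r
    refine ⟨q₁.comp (SchwartzMap.fderivCLM ℝ R3 V).toLinearMap +
      q₂.comp (twist V σ).toLinearMap, ?_, fun F hF => ?_⟩
    · exact (hc₁.comp (SchwartzMap.fderivCLM ℝ R3 V).continuous).add
        (hc₂.comp (twist V σ).continuous)
    obtain ⟨c₁, b₁⟩ := h₁ _ (fderiv_flat F hF)
    obtain ⟨c₂, b₂⟩ := h₂ _ (twist_flat σ F hF)
    have hfd : fderiv ℝ (fun x => ‖x‖ ^ σ • F x) =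
        (fun x => ‖x‖ ^ σ • SchwartzMap.fderivCLM ℝ R3 V F x) +
          (fun x => ‖x‖ ^ (σ - 2) • twist V σ F x) :=
      funext fun x => (hasFDerivAt_rpow_smul σ F hF x).fderiv
    refine ⟨?_, fun ξ => ?_⟩
    · push_cast
      refine contDiff_succ_iff_fderiv.2 ⟨fun x =>
        (hasFDerivAt_rpow_smul σ F hF x).differentiableAt, by simp, ?_⟩
      rw [hfd]
      exact c₁.add c₂
    · rw [← norm_iteratedFDeriv_fderiv, hfd, iteratedFDeriv_add_apply c₁.contDiffAt c₂.contDiffAt]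
      refine (mul_le_mul_of_nonneg_left (norm_add_le _ _) (by positivity)).trans ?_
      rw [mul_add]
      exact add_le_add (b₁ ξ) (b₂ ξ)

end Flat

noncomputable section

/-- The subspace of the Schwartz space of all `φ` whose Fourier transform vanishes at the origin
together with all its derivatives. -/
def testZ : Submodule ℂ 𝓢(R3, ℂ) where
  carrier := {φ | ∀ n : ℕ, iteratedFDeriv ℝ n (𝓕 φ : 𝓢(R3, ℂ)) 0 = 0}
  zero_mem' n := by
    have e : ⇑(𝓕 (0 : 𝓢(R3, ℂ)) : 𝓢(R3, ℂ)) = 0 := by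
      rw [← FourierTransform.fourierCLM_apply (R := ℂ), map_zero]; rfl
    rw [e, Pi.zero_def, iteratedFDeriv_fun_zero]; rfl
  add_mem' {φ ψ} hφ hψ n := by
    have e : ⇑(𝓕 (φ + ψ) : 𝓢(R3, ℂ)) = ⇑(𝓕 φ : 𝓢(R3, ℂ)) + ⇑(𝓕 ψ : 𝓢(R3, ℂ)) := by
      rw [FourierTransform.fourier_add]; rfl
    rw [e, iteratedFDeriv_add_apply ((𝓕 φ : 𝓢(R3, ℂ)).smooth n).contDiffAt
      ((𝓕 ψ : 𝓢(R3, ℂ)).smooth n).contDiffAt, hφ n, hψ n, add_zero]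
  smul_mem' c φ hφ n := by
    have e : ⇑(𝓕 (c • φ) : 𝓢(R3, ℂ)) = c • ⇑(𝓕 φ : 𝓢(R3, ℂ)) := by
      rw [FourierTransform.fourier_smul]; rfl
    rw [e, iteratedFDeriv_const_smul_apply ((𝓕 φ : 𝓢(R3, ℂ)).smooth n).contDiffAt, hφ n,
      smul_zero]

/-- The topological dual `𝓩'` of `testZ`, which is `𝓢'` modulo polynomials. -/
abbrev DistZ : Type := testZ →L[ℂ] ℂ

theorem rpow_two_pi_smul (σ : ℝ) (F : R3 → ℂ) :
    (fun ξ => ((2 * Real.pi * ‖ξ‖) ^ σ : ℝ) • F ξ) =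
      ((2 * Real.pi) ^ σ : ℝ) • fun ξ => (‖ξ‖ ^ σ : ℝ) • F ξ := by
  funext ξ
  rw [Real.mul_rpow (by positivity) (norm_nonneg _), mul_smul]
  rfl

/-- The Schwartz function `ξ ↦ (2π|ξ|)^σ φ̂(ξ)`. -/
def rieszSymbolMul (σ : ℝ) : testZ →L[ℂ] 𝓢(R3, ℂ) :=
  have hcd (φ : testZ) (n : ℕ) : ContDiff ℝ n fun ξ => (‖ξ‖ ^ σ : ℝ) • 𝓕 (φ : 𝓢(R3, ℂ)) ξ :=
    ((Flat.rpow_smul_bound n ℂ σ 0).choose_spec.2 (𝓕 (φ : 𝓢(R3, ℂ))) φ.2).1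
  have hbd (k n : ℕ) : ∃ q : Seminorm ℝ 𝓢(R3, ℂ), Continuous q ∧ ∀ (φ : testZ) ξ,
      ‖ξ‖ ^ k * ‖iteratedFDeriv ℝ n
        (fun ξ => ((2 * Real.pi * ‖ξ‖) ^ σ : ℝ) • 𝓕 (φ : 𝓢(R3, ℂ)) ξ) ξ‖ ≤
        ‖((2 * Real.pi) ^ σ : ℝ)‖ * q (𝓕 (φ : 𝓢(R3, ℂ))) := by
    obtain ⟨q, hc, hq⟩ := Flat.rpow_smul_bound n ℂ σ k
    refine ⟨q, hc, fun φ ξ => ?_⟩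
    have h := (hq (𝓕 (φ : 𝓢(R3, ℂ))) φ.2).2 ξ
    rw [rpow_two_pi_smul, iteratedFDeriv_const_smul_apply (hcd φ n).contDiffAt, norm_smul,
      mul_left_comm]
    rw [Real.rpow_natCast] at h
    gcongr
  let L : testZ →ₗ[ℂ] 𝓢(R3, ℂ) :=
    { toFun := fun φ =>
        { toFun := fun ξ => ((2 * Real.pi * ‖ξ‖) ^ σ : ℝ) • 𝓕 (φ : 𝓢(R3, ℂ)) ξ
          smooth' := by
            rw [rpow_two_pi_smul]
            exact contDiff_infty.2 fun n => contDiff_const.smul (hcd φ n)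
          decay' := fun k n => by
            obtain ⟨q, -, hq⟩ := hbd k n
            exact ⟨_, hq φ⟩ }
      map_add' := fun φ ψ => by
        ext ξ
        change ((2 * Real.pi * ‖ξ‖) ^ σ : ℝ) • 𝓕 ((φ : 𝓢(R3, ℂ)) + ψ) ξ =
          ((2 * Real.pi * ‖ξ‖) ^ σ : ℝ) • 𝓕 (φ : 𝓢(R3, ℂ)) ξ +
          ((2 * Real.pi * ‖ξ‖) ^ σ : ℝ) • 𝓕 (ψ : 𝓢(R3, ℂ)) ξ
        rw [FourierTransform.fourier_add, add_apply, smul_add]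
      map_smul' := fun c φ => by
        ext ξ
        change ((2 * Real.pi * ‖ξ‖) ^ σ : ℝ) • 𝓕 (c • (φ : 𝓢(R3, ℂ))) ξ =
          c • (((2 * Real.pi * ‖ξ‖) ^ σ : ℝ) • 𝓕 (φ : 𝓢(R3, ℂ)) ξ)
        rw [FourierTransform.fourier_smul, smul_apply, smul_comm] }
  { L with
    cont := by
      refine (schwartz_withSeminorms ℝ R3 ℂ).continuous_of_continuous_comp
        (L.restrictScalars ℝ) fun i => ?_
      obtain ⟨q, hc, hq⟩ := hbd i.1 i.2
      have hcont : Continuous fun φ : testZ =>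
          ‖((2 * Real.pi) ^ σ : ℝ)‖ * q (𝓕 (φ : 𝓢(R3, ℂ))) :=
        continuous_const.mul (hc.comp
          ((FourierTransform.fourierCLM ℂ 𝓢(R3, ℂ)).continuous.comp continuous_subtype_val))
      let Q : Seminorm ℝ testZ := (‖((2 * Real.pi) ^ σ : ℝ)‖₊ • q).comp
        (((FourierTransform.fourierCLM ℂ 𝓢(R3, ℂ)).comp testZ.subtypeL).toLinearMap.restrictScalars
          ℝ)
      refine Seminorm.continuous_of_le (q := Q) hcont fun φ => ?_
      exact SchwartzMap.seminorm_le_bound ℝ i.1 i.2 (L φ)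
        (mul_nonneg (norm_nonneg _) (apply_nonneg _ _)) (hq φ) }

theorem rieszSymbolMul_apply (σ : ℝ) (φ : testZ) (ξ : R3) :
    rieszSymbolMul σ φ ξ = ((2 * Real.pi * ‖ξ‖) ^ σ : ℝ) • 𝓕 (φ : 𝓢(R3, ℂ)) ξ := rfl

theorem rieszSymbolMul_flat (σ : ℝ) (φ : testZ) (n : ℕ) :
    iteratedFDeriv ℝ n (rieszSymbolMul σ φ) 0 = 0 := by
  obtain ⟨q, -, hq⟩ := Flat.rpow_smul_bound n ℂ σ (-1)
  obtain ⟨hcd, hbd⟩ := hq (𝓕 (φ : 𝓢(R3, ℂ))) φ.2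
  have e : ⇑(rieszSymbolMul σ φ) = ((2 * Real.pi) ^ σ : ℝ) •
      fun ξ => (‖ξ‖ ^ σ : ℝ) • 𝓕 (φ : 𝓢(R3, ℂ)) ξ := rpow_two_pi_smul σ _
  rw [e, iteratedFDeriv_const_smul_apply hcd.contDiffAt]
  set D := iteratedFDeriv ℝ n fun ξ => (‖ξ‖ ^ σ : ℝ) • 𝓕 (φ : 𝓢(R3, ℂ)) ξ with hD
  have hc : Continuous D := hcd.continuous_iteratedFDeriv le_rfl
  have h1 : Filter.Tendsto (fun ξ => ‖D ξ‖) (nhdsWithin 0 {0}ᶜ) (nhds ‖D 0‖) :=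
    (hc.norm.tendsto 0).mono_left nhdsWithin_le_nhds
  have h2 : Filter.Tendsto (fun ξ : R3 => q (𝓕 (φ : 𝓢(R3, ℂ))) * ‖ξ‖) (nhdsWithin 0 {0}ᶜ)
      (nhds 0) := by
    have : Continuous fun ξ : R3 => q (𝓕 (φ : 𝓢(R3, ℂ))) * ‖ξ‖ := by fun_prop
    simpa using (this.tendsto 0).mono_left nhdsWithin_le_nhds
  have h3 : ‖D 0‖ ≤ 0 := by
    refine le_of_tendsto_of_tendsto h1 h2 ?_
    filter_upwards [self_mem_nhdsWithin] with ξ hξ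
    have hpos : 0 < ‖ξ‖ := norm_pos_iff.2 hξ
    have := hbd ξ
    rw [Real.rpow_neg_one, inv_mul_le_iff₀ hpos] at this
    linarith
  rw [norm_le_zero_iff.1 h3, smul_zero]

/-- The operator `|D|^σ` on test functions: multiplication of the Fourier transform by
`(2π|ξ|)^σ`, which is the symbol `|ξ|^σ` for the Fourier transform normalised with
`exp (-2πi ⟪x, ξ⟫)`. -/
def rieszTest (σ : ℝ) : testZ →L[ℂ] testZ :=
  ((FourierTransform.fourierCLE ℂ 𝓢(R3, ℂ)).symm.toContinuousLinearMap.comp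
    (rieszSymbolMul σ)).codRestrict testZ fun φ n => by
      have e : 𝓕 (𝓕⁻ (rieszSymbolMul σ φ)) = rieszSymbolMul σ φ :=
        FourierTransform.fourier_fourierInv_eq _
      change iteratedFDeriv ℝ n ⇑(𝓕 (𝓕⁻ (rieszSymbolMul σ φ)) : 𝓢(R3, ℂ)) 0 = 0
      rw [e]
      exact rieszSymbolMul_flat σ φ n

/-- The defining property of `|D|^σ`. -/
theorem fourier_rieszTest (σ : ℝ) (φ : testZ) (ξ : R3) :
    (𝓕 (rieszTest σ φ : 𝓢(R3, ℂ)) : 𝓢(R3, ℂ)) ξ =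
      ((2 * Real.pi * ‖ξ‖) ^ σ : ℝ) • (𝓕 (φ : 𝓢(R3, ℂ)) : 𝓢(R3, ℂ)) ξ := by
  have e : 𝓕 (𝓕⁻ (rieszSymbolMul σ φ)) = rieszSymbolMul σ φ :=
    FourierTransform.fourier_fourierInv_eq _
  change (𝓕 (𝓕⁻ (rieszSymbolMul σ φ)) : 𝓢(R3, ℂ)) ξ = _
  rw [e]
  rfl

theorem lineDeriv_mem_testZ (v : R3) (φ : testZ) : ∂_{v} (φ : 𝓢(R3, ℂ)) ∈ testZ := by
  intro n
  have hg : (fun x : R3 => inner ℝ x v).HasTemperateGrowth := by fun_prop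
  have e : ⇑(𝓕 (∂_{v} (φ : 𝓢(R3, ℂ))) : 𝓢(R3, ℂ)) = (2 * Real.pi * Complex.I) •
      fun x => ContinuousLinearMap.lsmul ℝ ℝ (inner ℝ x v) ((𝓕 (φ : 𝓢(R3, ℂ)) : 𝓢(R3, ℂ)) x) := by
    rw [SchwartzMap.fourier_lineDerivOp_eq]
    ext x
    simp [SchwartzMap.smulLeftCLM_apply_apply hg]
  have hs : ContDiff ℝ ∞ fun x : R3 => inner ℝ x v := hg.1
  have h := (ContinuousLinearMap.lsmul ℝ ℝ (E := ℂ)).norm_iteratedFDeriv_le_of_bilinear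
    hs ((𝓕 (φ : 𝓢(R3, ℂ)) : 𝓢(R3, ℂ)).smooth ⊤) 0 (n := n) (by exact_mod_cast le_top)
  simp only [φ.2 _, norm_zero, mul_zero, Finset.sum_const_zero] at h
  have hcd : ContDiff ℝ ∞ fun x => ContinuousLinearMap.lsmul ℝ ℝ (inner ℝ x v)
      ((𝓕 (φ : 𝓢(R3, ℂ)) : 𝓢(R3, ℂ)) x) :=
    (ContinuousLinearMap.lsmul ℝ ℝ (E := ℂ)).isBoundedBilinearMap.contDiff.comp
      (hs.prodMk ((𝓕 (φ : 𝓢(R3, ℂ)) : 𝓢(R3, ℂ)).smooth ⊤))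
  rw [e, iteratedFDeriv_const_smul_apply (hcd.of_le (by exact_mod_cast le_top)).contDiffAt,
    norm_eq_zero.1 (le_antisymm h (norm_nonneg _)), smul_zero]

/-- The partial derivative `∂_j` on test functions. -/
def partialTest (j : Fin 3) : testZ →L[ℂ] testZ :=
  ((lineDerivOpCLM ℂ 𝓢(R3, ℂ) (EuclideanSpace.single j (1 : ℝ))).comp testZ.subtypeL).codRestrict
    testZ fun φ => lineDeriv_mem_testZ _ φ

/-- `|D|^σ` on distributions, by duality (its symbol is even). In particular `(-Δ)^θ` is
`riesz (2 * θ)`. -/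
def riesz (σ : ℝ) (f : DistZ) : DistZ := f.comp (rieszTest σ)

/-- The distributional partial derivative `∂_j`. -/
def partialD (j : Fin 3) (f : DistZ) : DistZ := -f.comp (partialTest j)

/-- The Laplacian. -/
def laplace (f : DistZ) : DistZ := ∑ j, partialD j (partialD j f)

/-- The divergence of a vector field. -/
def divergence (u : Fin 3 → DistZ) : DistZ := ∑ j, partialD j (u j)

/-- The space `L²(ℝ³)`. -/
abbrev L2 : Type := Lp ℂ 2 (volume : Measure R3)

/-- An `L²` function as a distribution, `φ ↦ ∫ g φ`. -/
def ofL2 (g : L2) : DistZ :=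
  ((Lp.toTemperedDistributionCLM ℂ volume 2 g : 𝓢'(R3, ℂ)) : 𝓢(R3, ℂ) →L[ℂ] ℂ).comp testZ.subtypeL

theorem ofL2_apply (g : L2) (φ : testZ) : ofL2 g φ = ∫ x, (φ : 𝓢(R3, ℂ)) x * g x :=
  Lp.toTemperedDistribution_apply g (φ : 𝓢(R3, ℂ))

/-- The function `h` represents the distribution `f`, that is, `f` is `φ ↦ ∫ h φ`. -/
def IsFunction (f : DistZ) (h : R3 → ℂ) : Prop :=
  ∀ φ : testZ, Integrable (fun x => h x * (φ : 𝓢(R3, ℂ)) x) ∧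
    f φ = ∫ x, h x * (φ : 𝓢(R3, ℂ)) x

/-- The Fourier transform of the distribution `f` is the function `g`. -/
def HasFourier (f : DistZ) (g : R3 → ℂ) : Prop :=
  ∀ φ : testZ, Integrable (fun ξ => g ξ * (𝓕⁻ (φ : 𝓢(R3, ℂ)) : 𝓢(R3, ℂ)) ξ) ∧
    f φ = ∫ ξ, g ξ * (𝓕⁻ (φ : 𝓢(R3, ℂ)) : 𝓢(R3, ℂ)) ξ

/-- The `L^p` norm of a distribution: the norm of the function that represents it in `L^p`, and `∞`
if there is none (for `p < ∞` there is at most one such function). -/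
def normLp (p : ℝ≥0∞) (f : DistZ) : ℝ≥0∞ :=
  ⨅ (h : R3 → ℂ) (_ : MemLp h p volume) (_ : IsFunction f h), eLpNorm h p volume

/-- The norm of `Ḣ^1_m`, `‖|D| f‖_{L^m}`; it is finite exactly on that space. -/
def normRieszPotential (m : ℝ) (f : DistZ) : ℝ≥0∞ := normLp (ENNReal.ofReal m) (riesz 1 f)

/-- The norm `(∫ |ξ|² ⟨ξ⟩^(2s) |f̂(ξ)|² dξ)^(1/2)` of `|D|⁻¹ H^s`; it is `∞` if the Fourier
transform of `f` is not a function. -/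
def normDInvH (s : ℝ) (f : DistZ) : ℝ≥0∞ :=
  ⨅ (g : R3 → ℂ) (_ : AEStronglyMeasurable g volume) (_ : HasFourier f g),
    eLpNorm (fun ξ => ((2 * Real.pi * ‖ξ‖) * (1 + (2 * Real.pi * ‖ξ‖) ^ 2) ^ (s / 2) : ℝ) • g ξ)
      2 volume

/-- The norm `‖⟨D⟩^s g‖_{L²}` of the Bessel potential space `H^s`, `s ≥ 0`. -/
def normH (s : ℝ) (g : L2) : ℝ≥0∞ :=
  eLpNorm (fun ξ => ((1 + (2 * Real.pi * ‖ξ‖) ^ 2) ^ (s / 2) : ℝ) • (𝓕 g : L2) ξ) 2 volume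

/-- The norm of `(|D|⁻¹ H^s ∩ Ḣ^1_m) × (H^s ∩ L^m)`; it is finite exactly on that space. -/
def normData (m s : ℝ) (f : DistZ) (g : L2) : ℝ≥0∞ :=
  normDInvH s f + normRieszPotential m f + normH s g + eLpNorm g (ENNReal.ofReal m) volume

/-- The energy solutions `u ∈ C([0,∞), Ḣ^1) ∩ C^1([0,∞), L²)`, with time derivative `ut`, of
`u_tt - a² Δu - (b² - a²) ∇ div u + (-Δ)^θ u_t = 0`, `u(0) = u₀`, `u_t(0) = u₁`.
The time derivative of `u` and the equation are understood in the sense of distributions in `x`; by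
the continuity of `ut` the difference quotients of `u` then also converge in `L²`. -/
structure IsEnergySolution (a b θ : ℝ) (u₀ : Fin 3 → DistZ) (u₁ : Fin 3 → L2)
    (u : ℝ → Fin 3 → DistZ) (ut : ℝ → Fin 3 → L2) : Prop where
  continuousOn_abs_D : ∃ v : ℝ → Fin 3 → L2, ∀ k,
    ContinuousOn (fun t => v t k) (Set.Ici 0) ∧ ∀ t, 0 ≤ t → riesz 1 (u t k) = ofL2 (v t k)
  continuousOn_ut : ∀ k, ContinuousOn (fun t => ut t k) (Set.Ici 0)
  deriv_u : ∀ k t, 0 ≤ t → ∀ φ : testZ,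
    HasDerivWithinAt (fun τ => u τ k φ) (ofL2 (ut t k) φ) (Set.Ici 0) t
  equation : ∀ k t, 0 < t → ∀ φ : testZ,
    HasDerivAt (fun τ => ofL2 (ut τ k) φ)
      ((((a ^ 2 : ℝ) : ℂ) • laplace (u t k) +
        ((b ^ 2 - a ^ 2 : ℝ) : ℂ) • partialD k (divergence (u t)) -
        riesz (2 * θ) (ofL2 (ut t k))) φ) t
  initial_u : u 0 = u₀
  initial_ut : ut 0 = u₁

end

end ElasticWave

open ElasticWave

/-!
In frequency space, with `r = 2π|ξ|`, `V = r û` and `W = û_t`, the system reads `V' = r W`,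
`W' = -r Q V - r^(2θ) W`, where `Q` has the eigenvalue `b²` in the direction of `ξ` and `a²`
orthogonally to it. The projections to the two eigenspaces are bounded multipliers of `L²`, so the
solution splits into scalar modes, `V' = r W`, `W' = -λ r V - r^(2θ) W` with `λ ∈ {a², b²}`
(`isMode_longitudinal`, `isMode_transverse`).

For one mode the energy `(|W|² + λ|V|²) / 2`, perturbed by a small multiple of `η Re (V̄ W)` with
`η = min (r^(2θ-1)) (r^(1-2θ))`, is a Lyapunov functional with decay rate
`κ = η r = min (r^(2θ)) (r^(2-2θ))` up to a constant (`lyapunov_dissipation`). Hence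
`|V(t)| + |W(t)| ≤ C e^(-cκt) (|V(0)| + |W(0)|)` for almost every frequency
(`exists_mode_decay`, `exists_solution_decay`). Since the solutions are only distributional, the
equations are first integrated in time to identities between `L²` functions, which hold almost
everywhere because a distribution modulo polynomials determines its Fourier transform
(`HasFourier.unique`). They can be differentiated in `L²` on sets of frequencies on which all
multipliers are bounded (`IsMode.setIntegral_lyapunov_le`).

For `r ≥ 1` the rate `κ` is at least `1`, which gives exponential decay. For `r ≤ 1`,
`κ = r^(2M)` with `M = max (1 - θ) θ`. The Fourier transform of a function `h` in `L^m` satisfies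
`∫_{r ≤ R} |ĥ|² ≤ C R^(3(2-m)/m) ‖h‖²` (`exists_lintegral_rad_le`), and integrating the weight
`r^(2σ) e^(-2c r^(2M) t)` against this bound produces, by scaling, the power
`t^(-(2σ + 3(2-m)/m) / (2M))` (`exists_lintegral_weight_le`, `exists_weighted_decay`). The integral
converges at the origin if and only if `2σ + 3(2-m)/m > 0`. The choice `σ = s` gives the estimate
for the derivatives, and `σ = -1`, which needs `m < 6/5`, the one for `u` itself.
-/

namespace ElasticWave

/-! ### Fourier calculus for distributions modulo polynomials -/

/-- The angular frequency `2π|ξ|`, the symbol of `|D|`. -/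
noncomputable def rad (ξ : R3) : ℝ := 2 * Real.pi * ‖ξ‖

/-- The inverse Fourier transform of a test function, against which Fourier transforms of elements
of `DistZ` are paired. -/
noncomputable def freq (φ : testZ) : 𝓢(R3, ℂ) := 𝓕⁻ (φ : 𝓢(R3, ℂ))

theorem rad_nonneg (ξ : R3) : 0 ≤ rad ξ := by unfold rad; positivity

theorem rad_pos {ξ : R3} (h : ξ ≠ 0) : 0 < rad ξ := by
  have := norm_pos_iff.2 h
  unfold rad; positivity

theorem continuous_rad : Continuous rad := by unfold rad; fun_prop

theorem measurable_rad : Measurable rad := continuous_rad.measurable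

theorem ae_ne_zero : ∀ᵐ ξ : R3, ξ ≠ 0 := by
  simp [ae_iff]

theorem freq_apply (φ : testZ) (ξ : R3) : freq φ ξ = (𝓕 (φ : 𝓢(R3, ℂ)) : 𝓢(R3, ℂ)) (-ξ) := rfl

theorem fourier_freq (φ : testZ) : 𝓕 (freq φ) = (φ : 𝓢(R3, ℂ)) :=
  FourierTransform.fourier_fourierInv_eq _

theorem freq_injective {φ ψ : testZ} (h : ∀ ξ, freq φ ξ = freq ψ ξ) : φ = ψ := by
  have h' : freq φ = freq ψ := SchwartzMap.ext h
  apply Subtype.ext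
  rw [← fourier_freq, h', fourier_freq]

theorem freq_rieszTest (σ : ℝ) (φ : testZ) (ξ : R3) :
    freq (rieszTest σ φ) ξ = ((rad ξ ^ σ : ℝ) : ℂ) * freq φ ξ := by
  rw [freq_apply, fourier_rieszTest, norm_neg, freq_apply]
  rfl

theorem freq_partialTest (j : Fin 3) (φ : testZ) (ξ : R3) :
    freq (partialTest j φ) ξ = -(2 * Real.pi * Complex.I * (ξ j : ℂ)) * freq φ ξ := by
  rw [freq_apply, freq_apply]
  change (𝓕 (∂_{EuclideanSpace.single j (1 : ℝ)} (φ : 𝓢(R3, ℂ))) : 𝓢(R3, ℂ)) (-ξ) = _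
  rw [SchwartzMap.fourier_lineDerivOp_eq, smul_apply]
  have hg : (fun x : R3 => inner ℝ x (EuclideanSpace.single j (1 : ℝ))).HasTemperateGrowth := by
    fun_prop
  rw [SchwartzMap.smulLeftCLM_apply_apply hg]
  simp [EuclideanSpace.inner_single_right]
  ring

/-- Every smooth function with compact support away from the origin pairs as a test function. -/
theorem exists_freq_eq {χ : R3 → ℝ} (h₁ : ContDiff ℝ ∞ χ) (h₂ : HasCompactSupport χ)
    (h₃ : tsupport χ ⊆ {0}ᶜ) : ∃ φ : testZ, ∀ ξ, freq φ ξ = (χ ξ : ℂ) := by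
  have h₁' : ContDiff ℝ ∞ (fun x => (χ x : ℂ)) := Complex.ofRealCLM.contDiff.comp h₁
  have h₂' : HasCompactSupport (fun x => (χ x : ℂ)) := h₂.comp_left (g := Complex.ofReal) (by simp)
  set X : 𝓢(R3, ℂ) := h₂'.toSchwartzMap h₁' with hX
  have hXa : ∀ ξ, X ξ = (χ ξ : ℂ) := fun ξ => rfl
  have hinv : 𝓕⁻ (𝓕 X) = X := FourierTransform.fourierInv_fourier_eq X
  refine ⟨⟨𝓕 X, fun n => ?_⟩, fun ξ => ?_⟩
  · have hev : (⇑(𝓕 (𝓕 X) : 𝓢(R3, ℂ)) : R3 → ℂ) =ᶠ[nhds 0] fun _ => 0 := by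
      have h0 : (0 : R3) ∉ tsupport χ := fun h => h₃ h rfl
      have h1 := (notMem_tsupport_iff_eventuallyEq.1 h0)
      have h2 : Filter.Tendsto (fun x : R3 => -x) (nhds 0) (nhds 0) := by
        simpa using (continuous_neg (G := R3)).tendsto 0
      filter_upwards [h2.eventually h1] with x hx
      have h3 : (𝓕⁻ (𝓕 X) : 𝓢(R3, ℂ)) (-x) = (𝓕 (𝓕 X) : 𝓢(R3, ℂ)) (- -x) := rfl
      rw [neg_neg] at h3
      rw [← h3, hinv, hXa, hx]
      simp
    rw [(hev.iteratedFDeriv ℝ n).eq_of_nhds, iteratedFDeriv_fun_zero]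
    rfl
  · change (𝓕⁻ (𝓕 X) : 𝓢(R3, ℂ)) ξ = _
    rw [hinv, hXa]

/-- A bump function around each point away from the origin is a test function, so a Fourier
transform is locally integrable there; this is why it is determined by the distribution. -/
theorem ae_eq_zero_of_forall_freq {F : R3 → ℂ}
    (h : ∀ φ : testZ, Integrable (fun ξ => F ξ * freq φ ξ) ∧ ∫ ξ, F ξ * freq φ ξ = 0) :
    F =ᵐ[volume] 0 := by
  have hl : LocallyIntegrableOn F ({0}ᶜ : Set R3) := by
    intro x hx
    have hx' : 0 < ‖x‖ := norm_pos_iff.2 hx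
    let f : ContDiffBump x := ⟨‖x‖ / 4, ‖x‖ / 2, by positivity, by linarith⟩
    obtain ⟨φ, hφ⟩ := exists_freq_eq (χ := f) f.contDiff f.hasCompactSupport (by
      rw [f.tsupport_eq]
      intro y hy h0
      rw [Set.mem_singleton_iff] at h0
      subst h0
      simp only [Metric.mem_closedBall, dist_zero_left] at hy
      change ‖x‖ ≤ ‖x‖ / 2 at hy
      linarith)
    refine ⟨Metric.closedBall x (‖x‖ / 4), mem_nhdsWithin_of_mem_nhds
      (Metric.closedBall_mem_nhds _ (by positivity)), ?_⟩
    refine ((h φ).1.integrableOn (s := Metric.closedBall x (‖x‖ / 4))).congr_fun (fun y hy => ?_)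
      measurableSet_closedBall
    change F y * freq φ y = F y
    rw [hφ, f.one_of_mem_closedBall hy]
    simp
  have h2 := (isOpen_compl_singleton (x := (0 : R3))).ae_eq_zero_of_integral_contDiff_smul_eq_zero
    hl fun g hg hg' hs => by
      obtain ⟨φ, hφ⟩ := exists_freq_eq hg hg' hs
      rw [← (h φ).2]
      congr 1
      ext ξ
      rw [hφ, Complex.real_smul, mul_comm]
  filter_upwards [h2, ae_ne_zero] with ξ h3 h4
  exact h3 h4

namespace HasFourier

theorem apply {f : DistZ} {g : R3 → ℂ} (h : HasFourier f g) (φ : testZ) :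
    f φ = ∫ ξ, g ξ * freq φ ξ := (h φ).2

theorem integrable {f : DistZ} {g : R3 → ℂ} (h : HasFourier f g) (φ : testZ) :
    Integrable (fun ξ => g ξ * freq φ ξ) := (h φ).1

theorem unique {f : DistZ} {g g' : R3 → ℂ} (h : HasFourier f g) (h' : HasFourier f g') :
    g =ᵐ[volume] g' := by
  have := ae_eq_zero_of_forall_freq (F := fun ξ => g ξ - g' ξ) fun φ => by
    simp_rw [sub_mul]
    refine ⟨(h.integrable φ).sub (h'.integrable φ), ?_⟩
    rw [integral_sub (h.integrable φ) (h'.integrable φ), ← h.apply, ← h'.apply, sub_self]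
  filter_upwards [this] with ξ hξ
  exact sub_eq_zero.1 hξ

theorem add {f f' : DistZ} {g g' : R3 → ℂ} (h : HasFourier f g) (h' : HasFourier f' g') :
    HasFourier (f + f') (fun ξ => g ξ + g' ξ) := fun φ => by
  change Integrable (fun ξ => (g ξ + g' ξ) * freq φ ξ) ∧ _ = ∫ ξ, (g ξ + g' ξ) * freq φ ξ
  simp_rw [add_mul]
  refine ⟨(h.integrable φ).add (h'.integrable φ), ?_⟩
  rw [integral_add (h.integrable φ) (h'.integrable φ), ← h.apply, ← h'.apply]
  rfl

theorem zero : HasFourier 0 (fun _ => 0) := fun φ => by simp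

theorem smul {f : DistZ} {g : R3 → ℂ} (h : HasFourier f g) (c : ℂ) :
    HasFourier (c • f) (fun ξ => c * g ξ) := fun φ => by
  change Integrable (fun ξ => (c * g ξ) * freq φ ξ) ∧ _ = ∫ ξ, (c * g ξ) * freq φ ξ
  simp_rw [mul_assoc]
  refine ⟨(h.integrable φ).const_mul c, ?_⟩
  rw [integral_const_mul, ← h.apply]
  rfl

theorem sub {f f' : DistZ} {g g' : R3 → ℂ} (h : HasFourier f g) (h' : HasFourier f' g') :
    HasFourier (f - f') (fun ξ => g ξ - g' ξ) := by
  have := h.add (h'.smul (-1))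
  have e : f - f' = f + (-1 : ℂ) • f' := by
    ext φ
    change f φ - f' φ = f φ + (-1 : ℂ) * f' φ
    ring
  rw [e]
  simpa only [neg_one_mul, ← sub_eq_add_neg] using this

theorem sum {ι : Type*} (s : Finset ι) {f : ι → DistZ} {g : ι → R3 → ℂ}
    (h : ∀ i ∈ s, HasFourier (f i) (g i)) :
    HasFourier (∑ i ∈ s, f i) (fun ξ => ∑ i ∈ s, g i ξ) := by
  classical
  induction s using Finset.induction_on with
  | empty => simpa using zero
  | insert i s hi ih =>
    simp only [Finset.sum_insert hi]
    exact (h i (by simp)).add (ih fun j hj => h j (by simp [hj]))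

theorem riesz {f : DistZ} {g : R3 → ℂ} (h : HasFourier f g) (σ : ℝ) :
    HasFourier (riesz σ f) (fun ξ => ((rad ξ ^ σ : ℝ) : ℂ) * g ξ) := fun φ => by
  have e : ∀ ξ, ((rad ξ ^ σ : ℝ) : ℂ) * g ξ * freq φ ξ = g ξ * freq (rieszTest σ φ) ξ := fun ξ => by
    rw [freq_rieszTest]; ring
  change Integrable (fun ξ => ((rad ξ ^ σ : ℝ) : ℂ) * g ξ * freq φ ξ) ∧
    _ = ∫ ξ, ((rad ξ ^ σ : ℝ) : ℂ) * g ξ * freq φ ξ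
  simp_rw [e]
  exact h (rieszTest σ φ)

theorem partialD {f : DistZ} {g : R3 → ℂ} (h : HasFourier f g) (j : Fin 3) :
    HasFourier (partialD j f) (fun ξ => (2 * Real.pi * Complex.I * (ξ j : ℂ)) * g ξ) := fun φ => by
  have e : ∀ ξ, (2 * Real.pi * Complex.I * (ξ j : ℂ)) * g ξ * freq φ ξ =
      -(g ξ * freq (partialTest j φ) ξ) := fun ξ => by
    rw [freq_partialTest]; ring
  change Integrable (fun ξ => (2 * Real.pi * Complex.I * (ξ j : ℂ)) * g ξ * freq φ ξ) ∧
    _ = ∫ ξ, (2 * Real.pi * Complex.I * (ξ j : ℂ)) * g ξ * freq φ ξ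
  simp_rw [e]
  refine ⟨(h.integrable _).neg, ?_⟩
  rw [integral_neg, ← h.apply]
  rfl

end HasFourier

theorem integrable_memLp_two_mul {g : R3 → ℂ} (hg : MemLp g 2 volume) (F : 𝓢(R3, ℂ)) :
    Integrable (fun ξ => g ξ * F ξ) :=
  hg.integrable_mul (F.memLp 2 volume)

theorem hasFourier_ofL2 (g : L2) : HasFourier (ofL2 g) (𝓕 g : L2) := fun φ => by
  refine ⟨integrable_memLp_two_mul (Lp.memLp _) _, ?_⟩
  have h := congrArg (fun T : 𝓢'(R3, ℂ) => T (freq φ)) (Lp.fourier_toTemperedDistribution_eq g)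
  simp only [TemperedDistribution.fourier_apply, fourier_freq] at h
  change ((g : 𝓢'(R3, ℂ)) : 𝓢(R3, ℂ) →L[ℂ] ℂ) (φ : 𝓢(R3, ℂ)) = _
  refine h.trans ((Lp.toTemperedDistribution_apply _ _).trans ?_)
  congr 1
  ext ξ
  rw [smul_eq_mul, mul_comm]
  rfl

theorem freq_zero (φ : testZ) : freq φ 0 = 0 := by
  have h := φ.2 0
  rw [← norm_eq_zero, norm_iteratedFDeriv_zero, norm_eq_zero] at h
  rw [freq_apply, neg_zero, h]

theorem rieszTest_rieszTest (σ τ : ℝ) (φ : testZ) :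
    rieszTest σ (rieszTest τ φ) = rieszTest (σ + τ) φ := by
  refine freq_injective fun ξ => ?_
  rcases eq_or_ne ξ 0 with rfl | h
  · simp only [freq_zero]
  · rw [freq_rieszTest, freq_rieszTest, freq_rieszTest, Real.rpow_add (rad_pos h)]
    push_cast
    ring

theorem riesz_riesz (σ τ : ℝ) (f : DistZ) : riesz σ (riesz τ f) = riesz (τ + σ) f := by
  ext φ
  exact congrArg f (rieszTest_rieszTest τ σ φ)

theorem riesz_zero (f : DistZ) : riesz 0 f = f := by
  ext φ
  refine congrArg f (freq_injective fun ξ => ?_)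
  refine (freq_rieszTest 0 φ ξ).trans ?_
  simp

theorem eLpNorm_fourier (g : L2) : eLpNorm (𝓕 g : L2) 2 volume = eLpNorm g 2 volume := by
  rw [← ENNReal.toReal_eq_toReal_iff' (Lp.eLpNorm_ne_top _) (Lp.eLpNorm_ne_top _)]
  exact Lp.norm_fourier_eq g

/-- Plancherel: a distribution whose Fourier transform is square integrable is an `L²` function. -/
theorem normLp_two_le {f : DistZ} {g : R3 → ℂ} (hf : HasFourier f g)
    (hg : AEStronglyMeasurable g volume) : normLp 2 f ≤ eLpNorm g 2 volume := by
  rcases eq_or_ne (eLpNorm g 2 volume) ⊤ with h | h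
  · rw [h]; exact le_top
  have hm : MemLp g 2 volume := ⟨hg, lt_top_iff_ne_top.2 h⟩
  set G : L2 := hm.toLp g with hG
  have hF : HasFourier (ofL2 (𝓕⁻ G)) g := by
    have h1 := hasFourier_ofL2 (𝓕⁻ G)
    rw [FourierTransform.fourier_fourierInv_eq] at h1
    intro φ
    have e : (fun ξ => (G : R3 → ℂ) ξ * freq φ ξ) =ᵐ[volume] fun ξ => g ξ * freq φ ξ := by
      filter_upwards [hm.coeFn_toLp] with ξ hξ
      rw [hG, hξ]
    exact ⟨(integrable_congr e).1 (h1.integrable φ), (h1.apply φ).trans (integral_congr_ae e)⟩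
  have hfe : f = ofL2 (𝓕⁻ G) := by
    ext φ
    rw [hf.apply, hF.apply]
  have hfun : IsFunction f (𝓕⁻ G : L2) := fun φ => by
    refine ⟨integrable_memLp_two_mul (Lp.memLp _) _, ?_⟩
    rw [hfe, ofL2_apply]
    simp_rw [mul_comm]
  have h1 : normLp 2 f ≤ eLpNorm (𝓕⁻ G : L2) 2 volume := iInf₂_le_of_le ((𝓕⁻ G : L2) : R3 → ℂ)
    (Lp.memLp (𝓕⁻ G : L2)) (iInf_le _ hfun)
  refine h1.trans ?_
  rw [← eLpNorm_fourier, FourierTransform.fourier_fourierInv_eq, eLpNorm_congr_ae hm.coeFn_toLp]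

theorem normLp_two_riesz_le (σ : ℝ) (g : L2) :
    normLp 2 (riesz σ (ofL2 g)) ≤
      eLpNorm (fun ξ => ((rad ξ ^ σ : ℝ) : ℂ) * (𝓕 g : L2) ξ) 2 volume := by
  refine normLp_two_le ((hasFourier_ofL2 g).riesz σ) ?_
  exact (Complex.measurable_ofReal.comp (measurable_rad.pow_const σ)).aestronglyMeasurable.mul
    (Lp.aestronglyMeasurable _)

theorem le_normDInvH (s : ℝ) {f : DistZ} {v : L2} (h : riesz 1 f = ofL2 v) :
    eLpNorm (fun ξ => (((1 + rad ξ ^ 2) ^ (s / 2) : ℝ) : ℂ) * (𝓕 v : L2) ξ) 2 volume ≤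
      normDInvH s f := by
  refine le_iInf fun g => le_iInf fun _ => le_iInf fun hg => le_of_eq ?_
  have h1 := hg.riesz 1
  rw [h] at h1
  refine eLpNorm_congr_ae ?_
  filter_upwards [h1.unique (hasFourier_ofL2 v)] with ξ hξ
  rw [← hξ, Complex.real_smul, Real.rpow_one]
  change _ = ((rad ξ * (1 + rad ξ ^ 2) ^ (s / 2) : ℝ) : ℂ) * g ξ
  push_cast
  ring

/-- The distributional Fourier transform of an integrable function is its Fourier integral. -/
theorem hasFourier_of_integrable {f : DistZ} {h : R3 → ℂ} (hf : IsFunction f h)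
    (hi : Integrable h) : HasFourier f (𝓕 h) := fun φ => by
  have hb : Integrable (fun ξ => 𝓕 h ξ * freq φ ξ) := by
    refine (freq φ).integrable.bdd_mul (c := ∫ x, ‖h x‖)
      (VectorFourier.fourierIntegral_continuous Real.continuous_fourierChar
        (L := innerₗ R3) continuous_inner hi).aestronglyMeasurable (Filter.Eventually.of_forall fun ξ => ?_)
    exact VectorFourier.norm_fourierIntegral_le_integral_norm _ _ _ _ _
  refine ⟨hb, ?_⟩
  have := VectorFourier.integral_fourierIntegral_smul_eq_flip (L := innerₗ R3)
    Real.continuous_fourierChar continuous_inner hi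
    ((freq φ).integrable (μ := volume))
  change f φ = ∫ ξ, 𝓕 h ξ * freq φ ξ
  rw [(hf φ).2, ← fourier_freq]
  simp only [flip_innerₗ, smul_eq_mul] at this
  exact this.symm

theorem norm_fourier_le (h : R3 → ℂ) (ξ : R3) : ‖𝓕 h ξ‖ ≤ ∫ x, ‖h x‖ :=
  VectorFourier.norm_fourierIntegral_le_integral_norm _ _ _ _ _

/-! ### Multiplication operators on `L²` -/

/-- Multiplication by a bounded real function, as an operator on `L²`. -/
noncomputable def mulL {μ : R3 → ℝ} (h : MemLp (fun ξ => (μ ξ : ℂ)) ⊤ volume) : L2 →L[ℂ] L2 :=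
  (ContinuousLinearMap.mul ℂ ℂ).holderL volume ⊤ 2 2 (h.toLp _)

theorem mulL_coeFn {μ : R3 → ℝ} (h : MemLp (fun ξ => (μ ξ : ℂ)) ⊤ volume) (f : L2) :
    (mulL h f : R3 → ℂ) =ᵐ[volume] fun ξ => (μ ξ : ℂ) * f ξ := by
  filter_upwards [(ContinuousLinearMap.mul ℂ ℂ).coeFn_holder (r := 2) (h.toLp _) f, h.coeFn_toLp]
    with ξ h1 h2
  change ((ContinuousLinearMap.mul ℂ ℂ).holder 2 (h.toLp _) f) ξ = _
  rw [h1, h2]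
  rfl

theorem memLp_top_of_abs_le {μ : R3 → ℝ} (hμ : Measurable μ) (C : ℝ) (h : ∀ ξ, |μ ξ| ≤ C) :
    MemLp (fun ξ => (μ ξ : ℂ)) ⊤ volume :=
  memLp_top_of_bound (Complex.measurable_ofReal.comp hμ).aestronglyMeasurable C
    (Filter.Eventually.of_forall fun ξ => by simpa using h ξ)

/-! ### The equation in frequency space -/

/-- Pairing with a fixed test function, as a functional on `L²`. -/
noncomputable def ofL2CLM (φ : testZ) : L2 →L[ℂ] ℂ :=
  (PointwiseConvergenceCLM.evalCLM (RingHom.id ℂ) ℂ (φ : 𝓢(R3, ℂ))).comp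
    (Lp.toTemperedDistributionCLM ℂ volume 2)

theorem intervalIntegrable_of_continuousOn_Ici {g : ℝ → L2} (hg : ContinuousOn g (Set.Ici 0))
    {t : ℝ} (ht : 0 ≤ t) : IntervalIntegrable g volume 0 t :=
  (hg.mono (by rw [Set.uIcc_of_le ht]; exact Set.Icc_subset_Ici_self)).intervalIntegrable

theorem intervalIntegral_ofL2 {g : ℝ → L2} (hg : ContinuousOn g (Set.Ici 0)) {t : ℝ} (ht : 0 ≤ t)
    (φ : testZ) : ∫ τ in (0 : ℝ)..t, ofL2 (g τ) φ = ofL2 (∫ τ in (0 : ℝ)..t, g τ) φ := by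
  have hi := intervalIntegrable_of_continuousOn_Ici hg ht
  exact (ofL2CLM φ).intervalIntegral_comp_comm hi

theorem continuousOn_ofL2 {g : ℝ → L2} (hg : ContinuousOn g (Set.Ici 0)) (φ : testZ) :
    ContinuousOn (fun τ => ofL2 (g τ) φ) (Set.Ici 0) :=
  (ofL2CLM φ).continuous.comp_continuousOn hg

theorem intervalIntegral_fourier {g : ℝ → L2} (hg : ContinuousOn g (Set.Ici 0)) {t : ℝ}
    (ht : 0 ≤ t) :
    (𝓕 (∫ τ in (0 : ℝ)..t, g τ) : L2) = ∫ τ in (0 : ℝ)..t, (𝓕 (g τ) : L2) := by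
  have hi := intervalIntegrable_of_continuousOn_Ici hg ht
  exact ((Lp.fourierTransformₗᵢ R3 ℂ).toContinuousLinearEquiv.toContinuousLinearMap
    |>.intervalIntegral_comp_comm hi).symm

/-- The operator `∂_j ∂_k |D|⁻¹`. -/
noncomputable def secondOrder (j k : Fin 3) (f : DistZ) : DistZ :=
  partialD j (partialD k (riesz (-1) f))

/-- The cosine of the angle between `ξ` and the `j`-th coordinate axis. -/
noncomputable def dirCos (j : Fin 3) (ξ : R3) : ℝ := ξ j / ‖ξ‖

theorem measurable_dirCos (j : Fin 3) : Measurable (dirCos j) := by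
  unfold dirCos
  fun_prop

theorem abs_dirCos_le (j : Fin 3) (ξ : R3) : |dirCos j ξ| ≤ 1 := by
  unfold dirCos
  rw [abs_div, abs_norm]
  exact div_le_one_of_le₀ (PiLp.norm_apply_le ξ j) (norm_nonneg _)

theorem sum_dirCos_sq {ξ : R3} (h : ξ ≠ 0) : ∑ j, dirCos j ξ ^ 2 = 1 := by
  have h0 : ‖ξ‖ ^ 2 ≠ 0 := by positivity
  simp_rw [dirCos, div_pow]
  rw [← Finset.sum_div, ← EuclideanSpace.real_norm_sq_eq, div_self h0]

theorem HasFourier.secondOrder {f : DistZ} {g : R3 → ℂ} (h : HasFourier f g) (j k : Fin 3) :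
    HasFourier (secondOrder j k f)
      (fun ξ => (2 * Real.pi * Complex.I * (ξ j : ℂ)) * ((2 * Real.pi * Complex.I * (ξ k : ℂ)) *
        (((rad ξ ^ (-1 : ℝ) : ℝ) : ℂ) * g ξ))) :=
  ((h.riesz (-1)).partialD k).partialD j

theorem secondOrder_symbol (j k : Fin 3) {ξ : R3} (hξ : ξ ≠ 0) (z : ℂ) :
    (2 * Real.pi * Complex.I * (ξ j : ℂ)) * ((2 * Real.pi * Complex.I * (ξ k : ℂ)) *
        (((rad ξ ^ (-1 : ℝ) : ℝ) : ℂ) * z)) =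
      -((rad ξ : ℂ) * (dirCos j ξ * (dirCos k ξ * z))) := by
  have h0 : (‖ξ‖ : ℂ) ≠ 0 := by exact_mod_cast norm_ne_zero_iff.2 hξ
  have hpi : (Real.pi : ℂ) ≠ 0 := by exact_mod_cast Real.pi_ne_zero
  rw [Real.rpow_neg_one]
  simp only [rad, dirCos]
  push_cast
  field_simp
  rw [Complex.I_sq]
  ring

/-- The Volterra form of the system `V' = |ξ| W`, `W' = -lam |ξ| V - |ξ|^(2θ) W` for a scalar
component of the solution in frequency space, `V` standing for `|ξ| û` and `W` for `û_t`. The time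
integrals are Bochner integrals in `L²`, so that the unbounded multipliers act on honest functions
only. -/
structure IsMode (lam θ : ℝ) (V W : ℝ → L2) : Prop where
  continuousOn_left : ContinuousOn V (Set.Ici 0)
  continuousOn_right : ContinuousOn W (Set.Ici 0)
  left : ∀ t, 0 ≤ t → (V t : R3 → ℂ) =ᵐ[volume] fun ξ =>
    V 0 ξ + (rad ξ : ℂ) * (∫ τ in (0 : ℝ)..t, W τ) ξ
  right : ∀ t, 0 ≤ t → (W t : R3 → ℂ) =ᵐ[volume] fun ξ =>
    W 0 ξ - (lam : ℂ) * ((rad ξ : ℂ) * (∫ τ in (0 : ℝ)..t, V τ) ξ) -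
      ((rad ξ ^ (2 * θ) : ℝ) : ℂ) * (∫ τ in (0 : ℝ)..t, W τ) ξ

section Solution

variable {a b θ : ℝ} {u₀ : Fin 3 → DistZ} {u₁ : Fin 3 → L2}
  {u : ℝ → Fin 3 → DistZ} {ut : ℝ → Fin 3 → L2}

theorem IsEnergySolution.sub_eq (h : IsEnergySolution a b θ u₀ u₁ u ut) (k : Fin 3) {t : ℝ}
    (ht : 0 ≤ t) : u t k - u 0 k = ofL2 (∫ τ in (0 : ℝ)..t, ut τ k) := by
  ext φ
  have hs : Set.Icc 0 t ⊆ Set.Ici (0 : ℝ) := Set.Icc_subset_Ici_self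
  have h1 := intervalIntegral.integral_eq_sub_of_hasDerivAt_of_le (f := fun τ => u τ k φ)
    (f' := fun τ => ofL2 (ut τ k) φ) ht
    (fun τ hτ => ((h.deriv_u k τ hτ.1 φ).continuousWithinAt).mono hs)
    (fun τ hτ => (h.deriv_u k τ hτ.1.le φ).hasDerivAt (Ici_mem_nhds hτ.1))
    (((continuousOn_ofL2 (h.continuousOn_ut k) φ).mono
      (by rw [Set.uIcc_of_le ht]; exact hs)).intervalIntegrable)
  rw [intervalIntegral_ofL2 (h.continuousOn_ut k) ht] at h1
  exact h1.symm

/-- The relation `∂_t |D|u = |D| u_t`, integrated in time, in frequency space. -/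
theorem IsEnergySolution.left (h : IsEnergySolution a b θ u₀ u₁ u ut) {v : ℝ → Fin 3 → L2}
    (hv : ∀ k t, 0 ≤ t → riesz 1 (u t k) = ofL2 (v t k)) (k : Fin 3) {t : ℝ} (ht : 0 ≤ t) :
    ((𝓕 (v t k) : L2) : R3 → ℂ) =ᵐ[volume] fun ξ => (𝓕 (v 0 k) : L2) ξ +
      (rad ξ : ℂ) * (∫ τ in (0 : ℝ)..t, (𝓕 (ut τ k) : L2)) ξ := by
  have e : ofL2 (v t k) - ofL2 (v 0 k) = riesz 1 (ofL2 (∫ τ in (0 : ℝ)..t, ut τ k)) := by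
    rw [← h.sub_eq k ht, ← hv k t ht, ← hv k 0 le_rfl]
    rfl
  have h1 := (hasFourier_ofL2 (v t k)).sub (hasFourier_ofL2 (v 0 k))
  rw [e] at h1
  have h2 := h1.unique ((hasFourier_ofL2 _).riesz 1)
  rw [intervalIntegral_fourier (h.continuousOn_ut k) ht] at h2
  filter_upwards [h2] with ξ hξ
  rw [Real.rpow_one] at hξ
  rw [← hξ]
  ring

/-- The equation, integrated in time. As `v = |D| u` lies in `L²` and `u` need not, the second
derivatives of `u` are written as `∂_j ∂_k |D|⁻¹ v`. -/
theorem IsEnergySolution.ut_sub_eq (h : IsEnergySolution a b θ u₀ u₁ u ut) {v : ℝ → Fin 3 → L2}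
    (hvc : ∀ k, ContinuousOn (fun t => v t k) (Set.Ici 0))
    (hv : ∀ k t, 0 ≤ t → riesz 1 (u t k) = ofL2 (v t k)) (k : Fin 3) {t : ℝ} (ht : 0 ≤ t) :
    ofL2 (ut t k) - ofL2 (ut 0 k) =
      ((a ^ 2 : ℝ) : ℂ) • (∑ j, secondOrder j j (ofL2 (∫ τ in (0 : ℝ)..t, v τ k))) +
      ((b ^ 2 - a ^ 2 : ℝ) : ℂ) • (∑ j, secondOrder k j (ofL2 (∫ τ in (0 : ℝ)..t, v τ j))) -
      riesz (2 * θ) (ofL2 (∫ τ in (0 : ℝ)..t, ut τ k)) := by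
  ext φ
  have hs : Set.Icc 0 t ⊆ Set.Ici (0 : ℝ) := Set.Icc_subset_Ici_self
  -- The test function `ψ` with `secondOrder i j f φ = f ψ`.
  let A : Fin 3 → Fin 3 → testZ := fun i j => rieszTest (-1) (partialTest j (partialTest i φ))
  have hA : ∀ i j (f : DistZ), secondOrder i j f φ = f (A i j) := fun i j f => by
    change -(-(f (A i j))) = _
    rw [neg_neg]
  have hu : ∀ τ, 0 ≤ τ → ∀ j, u τ j = riesz (-1) (ofL2 (v τ j)) := fun τ hτ j => by
    rw [← hv j τ hτ, riesz_riesz, add_neg_cancel, riesz_zero]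
  set G : ℝ → ℂ := fun τ => ((a ^ 2 : ℝ) : ℂ) * (∑ j, ofL2 (v τ k) (A j j)) +
    ((b ^ 2 - a ^ 2 : ℝ) : ℂ) * (∑ j, ofL2 (v τ j) (A k j)) -
      ofL2 (ut τ k) (rieszTest (2 * θ) φ) with hG
  have hGeq : ∀ τ, 0 ≤ τ → ((((a ^ 2 : ℝ) : ℂ) • laplace (u τ k) +
        ((b ^ 2 - a ^ 2 : ℝ) : ℂ) • partialD k (divergence (u τ)) -
        riesz (2 * θ) (ofL2 (ut τ k))) φ) = G τ := fun τ hτ => by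
    have e1 : laplace (u τ k) φ = ∑ j, ofL2 (v τ k) (A j j) := by
      rw [laplace, sum_apply]
      refine Finset.sum_congr rfl fun j _ => ?_
      rw [hu τ hτ k, ← hA]
      rfl
    have e2 : partialD k (divergence (u τ)) φ = ∑ j, ofL2 (v τ j) (A k j) := by
      change -(divergence (u τ) (partialTest k φ)) = _
      rw [divergence, sum_apply, ← Finset.sum_neg_distrib]
      refine Finset.sum_congr rfl fun j _ => ?_
      rw [hu τ hτ j, ← hA]
      rfl
    change ((a ^ 2 : ℝ) : ℂ) * laplace (u τ k) φ + ((b ^ 2 - a ^ 2 : ℝ) : ℂ) *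
      partialD k (divergence (u τ)) φ - _ = _
    rw [e1, e2]
    rfl
  have ii : ∀ (g : ℝ → L2) (ψ : testZ), ContinuousOn g (Set.Ici 0) →
      IntervalIntegrable (fun τ => ofL2 (g τ) ψ) volume 0 t := fun g ψ hg =>
    ((continuousOn_ofL2 hg ψ).mono (by rw [Set.uIcc_of_le ht]; exact hs)).intervalIntegrable
  have i1 : IntervalIntegrable (fun τ => ∑ j, ofL2 (v τ k) (A j j)) volume 0 t :=
    by simpa only [Finset.sum_fn] using
      IntervalIntegrable.sum Finset.univ fun j _ => ii (fun τ => v τ k) (A j j) (hvc k)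
  have i2 : IntervalIntegrable (fun τ => ∑ j, ofL2 (v τ j) (A k j)) volume 0 t :=
    by simpa only [Finset.sum_fn] using
      IntervalIntegrable.sum Finset.univ fun j _ => ii (fun τ => v τ j) (A k j) (hvc j)
  have i3 := ii (fun τ => ut τ k) (rieszTest (2 * θ) φ) (h.continuousOn_ut k)
  have h1 := intervalIntegral.integral_eq_sub_of_hasDerivAt_of_le
    (f := fun τ => ofL2 (ut τ k) φ) (f' := G) ht
    ((continuousOn_ofL2 (h.continuousOn_ut k) φ).mono hs)
    (fun τ hτ => (h.equation k τ hτ.1 φ).congr_deriv (hGeq τ hτ.1.le))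
    (((i1.const_mul _).add (i2.const_mul _)).sub i3)
  rw [hG, intervalIntegral.integral_sub ((i1.const_mul _).add (i2.const_mul _)) i3,
    intervalIntegral.integral_add (i1.const_mul _) (i2.const_mul _),
    intervalIntegral.integral_const_mul, intervalIntegral.integral_const_mul,
    intervalIntegral.integral_finsetSum (fun j _ => ii (fun τ => v τ k) (A j j) (hvc k)),
    intervalIntegral.integral_finsetSum (fun j _ => ii (fun τ => v τ j) (A k j) (hvc j)),
    intervalIntegral_ofL2 (h.continuousOn_ut k) ht] at h1
  simp_rw [fun j => intervalIntegral_ofL2 (hvc j) ht] at h1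
  change ofL2 (ut t k) φ - ofL2 (ut 0 k) φ = _
  rw [← h1]
  change _ = ((a ^ 2 : ℝ) : ℂ) * (∑ j, secondOrder j j (ofL2 (∫ τ in (0 : ℝ)..t, v τ k))) φ +
      ((b ^ 2 - a ^ 2 : ℝ) : ℂ) * (∑ j, secondOrder k j (ofL2 (∫ τ in (0 : ℝ)..t, v τ j))) φ - _
  rw [sum_apply, sum_apply]
  simp_rw [hA]
  rfl

/-- The equation, integrated in time, in frequency space. -/
theorem IsEnergySolution.right (h : IsEnergySolution a b θ u₀ u₁ u ut) {v : ℝ → Fin 3 → L2}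
    (hvc : ∀ k, ContinuousOn (fun t => v t k) (Set.Ici 0))
    (hv : ∀ k t, 0 ≤ t → riesz 1 (u t k) = ofL2 (v t k)) (k : Fin 3) {t : ℝ} (ht : 0 ≤ t) :
    ((𝓕 (ut t k) : L2) : R3 → ℂ) =ᵐ[volume] fun ξ => (𝓕 (ut 0 k) : L2) ξ -
      (rad ξ : ℂ) * ((a ^ 2 : ℝ) * (∫ τ in (0 : ℝ)..t, (𝓕 (v τ k) : L2)) ξ +
        (b ^ 2 - a ^ 2 : ℝ) * (dirCos k ξ * ∑ j, dirCos j ξ *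
          (∫ τ in (0 : ℝ)..t, (𝓕 (v τ j) : L2)) ξ)) -
      ((rad ξ ^ (2 * θ) : ℝ) : ℂ) * (∫ τ in (0 : ℝ)..t, (𝓕 (ut τ k) : L2)) ξ := by
  have h1 := (hasFourier_ofL2 (ut t k)).sub (hasFourier_ofL2 (ut 0 k))
  rw [h.ut_sub_eq hvc hv k ht] at h1
  have h2 := h1.unique ((((HasFourier.sum Finset.univ fun j _ =>
    (hasFourier_ofL2 (∫ τ in (0 : ℝ)..t, v τ k)).secondOrder j j).smul ((a ^ 2 : ℝ) : ℂ)).add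
    ((HasFourier.sum Finset.univ fun j _ =>
    (hasFourier_ofL2 (∫ τ in (0 : ℝ)..t, v τ j)).secondOrder k j).smul
      ((b ^ 2 - a ^ 2 : ℝ) : ℂ))).sub ((hasFourier_ofL2 _).riesz (2 * θ)))
  simp_rw [intervalIntegral_fourier (h.continuousOn_ut k) ht,
    fun j => intervalIntegral_fourier (hvc j) ht] at h2
  filter_upwards [h2, ae_ne_zero] with ξ hξ h0
  simp_rw [secondOrder_symbol _ _ h0] at hξ
  have hs : ∑ j, (dirCos j ξ : ℂ) ^ 2 = 1 := by exact_mod_cast sum_dirCos_sq h0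
  rw [sub_eq_iff_eq_add] at hξ
  rw [hξ]
  simp only [Fin.sum_univ_three] at hs ⊢
  linear_combination (-((a ^ 2 : ℝ) : ℂ) * rad ξ *
    (∫ τ in (0 : ℝ)..t, (𝓕 (v τ k) : L2)) ξ) * hs

end Solution

/-! ### Longitudinal and transverse modes -/

theorem memLp_dirCos (j : Fin 3) : MemLp (fun ξ => (dirCos j ξ : ℂ)) ⊤ volume :=
  memLp_top_of_abs_le (measurable_dirCos j) 1 (abs_dirCos_le j)

/-- The component of a vector field in the direction of the frequency. -/
noncomputable def longitudinal (F : Fin 3 → L2) : L2 := ∑ j, mulL (memLp_dirCos j) (F j)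

/-- The `k`-th component of the part of a vector field orthogonal to the frequency. -/
noncomputable def transverse (k : Fin 3) (F : Fin 3 → L2) : L2 :=
  F k - mulL (memLp_dirCos k) (longitudinal F)

theorem longitudinal_coeFn (F : Fin 3 → L2) :
    (longitudinal F : R3 → ℂ) =ᵐ[volume] fun ξ => ∑ j, (dirCos j ξ : ℂ) * F j ξ := by
  have h : ∀ᵐ ξ : R3, ∀ j, (mulL (memLp_dirCos j) (F j) : R3 → ℂ) ξ = (dirCos j ξ : ℂ) * F j ξ :=
    ae_all_iff.2 fun j => mulL_coeFn _ _
  simp only [longitudinal, Fin.sum_univ_three]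
  filter_upwards [h, Lp.coeFn_add (mulL (memLp_dirCos 0) (F 0) + mulL (memLp_dirCos 1) (F 1))
      (mulL (memLp_dirCos 2) (F 2)), Lp.coeFn_add (mulL (memLp_dirCos 0) (F 0))
      (mulL (memLp_dirCos 1) (F 1))] with ξ h0 h1 h2
  rw [h1, Pi.add_apply, h2, Pi.add_apply, h0, h0, h0]

theorem transverse_coeFn (k : Fin 3) (F : Fin 3 → L2) :
    (transverse k F : R3 → ℂ) =ᵐ[volume] fun ξ =>
      F k ξ - (dirCos k ξ : ℂ) * ∑ j, (dirCos j ξ : ℂ) * F j ξ := by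
  filter_upwards [longitudinal_coeFn F, mulL_coeFn (memLp_dirCos k) (longitudinal F),
    Lp.coeFn_sub (F k) (mulL (memLp_dirCos k) (longitudinal F))] with ξ h1 h2 h3
  rw [transverse, h3, Pi.sub_apply, h2, h1]

theorem continuousOn_longitudinal {F : ℝ → Fin 3 → L2} {s : Set ℝ}
    (hF : ∀ k, ContinuousOn (fun t => F t k) s) : ContinuousOn (fun t => longitudinal (F t)) s :=
  continuousOn_finsetSum _ fun j _ => (mulL (memLp_dirCos j)).continuous.comp_continuousOn (hF j)

theorem continuousOn_transverse (k : Fin 3) {F : ℝ → Fin 3 → L2} {s : Set ℝ}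
    (hF : ∀ k, ContinuousOn (fun t => F t k) s) : ContinuousOn (fun t => transverse k (F t)) s :=
  (hF k).sub ((mulL (memLp_dirCos k)).continuous.comp_continuousOn (continuousOn_longitudinal hF))

theorem intervalIntegral_longitudinal {F : ℝ → Fin 3 → L2}
    (hF : ∀ k, ContinuousOn (fun t => F t k) (Set.Ici 0)) {t : ℝ} (ht : 0 ≤ t) :
    ∫ τ in (0 : ℝ)..t, longitudinal (F τ) = longitudinal fun k => ∫ τ in (0 : ℝ)..t, F τ k := by
  have hi : ∀ j, IntervalIntegrable (fun τ => mulL (memLp_dirCos j) (F τ j)) volume 0 t :=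
    fun j => intervalIntegrable_of_continuousOn_Ici
      ((mulL (memLp_dirCos j)).continuous.comp_continuousOn (hF j)) ht
  simp only [longitudinal]
  rw [intervalIntegral.integral_finsetSum fun j _ => hi j]
  exact Finset.sum_congr rfl fun j _ => (mulL (memLp_dirCos j)).intervalIntegral_comp_comm
    (intervalIntegrable_of_continuousOn_Ici (hF j) ht)

theorem intervalIntegral_transverse (k : Fin 3) {F : ℝ → Fin 3 → L2}
    (hF : ∀ k, ContinuousOn (fun t => F t k) (Set.Ici 0)) {t : ℝ} (ht : 0 ≤ t) :
    ∫ τ in (0 : ℝ)..t, transverse k (F τ) = transverse k fun k => ∫ τ in (0 : ℝ)..t, F τ k := by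
  simp only [transverse]
  have h1 := continuousOn_longitudinal hF
  have hi : IntervalIntegrable (fun τ => mulL (memLp_dirCos k) (longitudinal (F τ))) volume 0 t :=
    intervalIntegrable_of_continuousOn_Ici
      ((mulL (memLp_dirCos k)).continuous.comp_continuousOn h1) ht
  rw [intervalIntegral.integral_sub (intervalIntegrable_of_continuousOn_Ici (hF k) ht) hi,
    ← intervalIntegral_longitudinal hF ht]
  congr 1
  exact (mulL (memLp_dirCos k)).intervalIntegral_comp_comm
    (intervalIntegrable_of_continuousOn_Ici h1 ht)

section Modes

variable {a b θ : ℝ} {V W : ℝ → Fin 3 → L2}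

theorem isMode_longitudinal (hV : ∀ k, ContinuousOn (fun t => V t k) (Set.Ici 0))
    (hW : ∀ k, ContinuousOn (fun t => W t k) (Set.Ici 0))
    (hl : ∀ k t, 0 ≤ t → (V t k : R3 → ℂ) =ᵐ[volume] fun ξ => V 0 k ξ +
      (rad ξ : ℂ) * (∫ τ in (0 : ℝ)..t, W τ k) ξ)
    (hr : ∀ k t, 0 ≤ t → (W t k : R3 → ℂ) =ᵐ[volume] fun ξ => W 0 k ξ -
      (rad ξ : ℂ) * ((a ^ 2 : ℝ) * (∫ τ in (0 : ℝ)..t, V τ k) ξ +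
        (b ^ 2 - a ^ 2 : ℝ) * (dirCos k ξ * ∑ j, dirCos j ξ * (∫ τ in (0 : ℝ)..t, V τ j) ξ)) -
      ((rad ξ ^ (2 * θ) : ℝ) : ℂ) * (∫ τ in (0 : ℝ)..t, W τ k) ξ) :
    IsMode (b ^ 2) θ (fun t => longitudinal (V t)) (fun t => longitudinal (W t)) where
  continuousOn_left := continuousOn_longitudinal hV
  continuousOn_right := continuousOn_longitudinal hW
  left t ht := by
    rw [intervalIntegral_longitudinal hW ht]
    filter_upwards [longitudinal_coeFn (V t), longitudinal_coeFn (V 0), longitudinal_coeFn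
      (fun k => ∫ τ in (0 : ℝ)..t, W τ k), ae_all_iff.2 fun k => hl k t ht] with ξ h1 h2 h3 h4
    rw [h1, h2, h3]
    simp only [h4, Fin.sum_univ_three]
    ring
  right t ht := by
    rw [intervalIntegral_longitudinal hW ht, intervalIntegral_longitudinal hV ht]
    filter_upwards [longitudinal_coeFn (W t), longitudinal_coeFn (W 0), longitudinal_coeFn
      (fun k => ∫ τ in (0 : ℝ)..t, W τ k), longitudinal_coeFn
      (fun k => ∫ τ in (0 : ℝ)..t, V τ k), ae_all_iff.2 fun k => hr k t ht, ae_ne_zero]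
      with ξ h1 h2 h3 h5 h4 h0
    have hs : ∑ j, (dirCos j ξ : ℂ) ^ 2 = 1 := by exact_mod_cast sum_dirCos_sq h0
    rw [h1, h2, h3, h5]
    simp only [h4, Fin.sum_univ_three] at hs ⊢
    push_cast
    linear_combination (-(rad ξ : ℂ) * ((b : ℂ) ^ 2 - (a : ℂ) ^ 2) *
      (dirCos 0 ξ * (∫ τ in (0 : ℝ)..t, V τ 0) ξ + dirCos 1 ξ * (∫ τ in (0 : ℝ)..t, V τ 1) ξ +
        dirCos 2 ξ * (∫ τ in (0 : ℝ)..t, V τ 2) ξ)) * hs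

theorem isMode_transverse (k : Fin 3) (hV : ∀ k, ContinuousOn (fun t => V t k) (Set.Ici 0))
    (hW : ∀ k, ContinuousOn (fun t => W t k) (Set.Ici 0))
    (hl : ∀ k t, 0 ≤ t → (V t k : R3 → ℂ) =ᵐ[volume] fun ξ => V 0 k ξ +
      (rad ξ : ℂ) * (∫ τ in (0 : ℝ)..t, W τ k) ξ)
    (hr : ∀ k t, 0 ≤ t → (W t k : R3 → ℂ) =ᵐ[volume] fun ξ => W 0 k ξ -
      (rad ξ : ℂ) * ((a ^ 2 : ℝ) * (∫ τ in (0 : ℝ)..t, V τ k) ξ +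
        (b ^ 2 - a ^ 2 : ℝ) * (dirCos k ξ * ∑ j, dirCos j ξ * (∫ τ in (0 : ℝ)..t, V τ j) ξ)) -
      ((rad ξ ^ (2 * θ) : ℝ) : ℂ) * (∫ τ in (0 : ℝ)..t, W τ k) ξ) :
    IsMode (a ^ 2) θ (fun t => transverse k (V t)) (fun t => transverse k (W t)) where
  continuousOn_left := continuousOn_transverse k hV
  continuousOn_right := continuousOn_transverse k hW
  left t ht := by
    rw [intervalIntegral_transverse k hW ht]
    filter_upwards [transverse_coeFn k (V t), transverse_coeFn k (V 0), transverse_coeFn k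
      (fun k => ∫ τ in (0 : ℝ)..t, W τ k), ae_all_iff.2 fun k => hl k t ht] with ξ h1 h2 h3 h4
    rw [h1, h2, h3]
    simp only [h4, Fin.sum_univ_three]
    ring
  right t ht := by
    rw [intervalIntegral_transverse k hW ht, intervalIntegral_transverse k hV ht]
    filter_upwards [transverse_coeFn k (W t), transverse_coeFn k (W 0), transverse_coeFn k
      (fun k => ∫ τ in (0 : ℝ)..t, W τ k), transverse_coeFn k
      (fun k => ∫ τ in (0 : ℝ)..t, V τ k), ae_all_iff.2 fun k => hr k t ht, ae_ne_zero]
      with ξ h1 h2 h3 h5 h4 h0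
    have hs : ∑ j, (dirCos j ξ : ℂ) ^ 2 = 1 := by exact_mod_cast sum_dirCos_sq h0
    rw [h1, h2, h3, h5]
    simp only [h4, Fin.sum_univ_three] at hs ⊢
    push_cast
    linear_combination ((dirCos k ξ : ℂ) * (rad ξ : ℂ) * ((b : ℂ) ^ 2 - (a : ℂ) ^ 2) *
      (dirCos 0 ξ * (∫ τ in (0 : ℝ)..t, V τ 0) ξ + dirCos 1 ξ * (∫ τ in (0 : ℝ)..t, V τ 1) ξ +
        dirCos 2 ξ * (∫ τ in (0 : ℝ)..t, V τ 2) ξ)) * hs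

end Modes

/-! ### Dissipation of a single mode -/

/-- The decay rate of the mode of angular frequency `r`. -/
noncomputable def rate (θ r : ℝ) : ℝ := min (r ^ (2 * θ)) (r ^ (2 - 2 * θ))

/-- The weight of the cross term in the Lyapunov functional of the mode of angular frequency `r`. -/
noncomputable def crossWeight (θ r : ℝ) : ℝ := min (r ^ (2 * θ - 1)) (r ^ (1 - 2 * θ))

section Scalar

variable {θ r : ℝ}

theorem crossWeight_pos (hr : 0 < r) : 0 < crossWeight θ r := by unfold crossWeight; positivity

theorem rate_pos (hr : 0 < r) : 0 < rate θ r := by unfold rate; positivity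

theorem crossWeight_le_one (hr : 0 < r) : crossWeight θ r ≤ 1 := by
  by_contra! h
  obtain ⟨h1, h2⟩ := lt_min_iff.1 h
  have h3 : r ^ (2 * θ - 1) * r ^ (1 - 2 * θ) = 1 := by
    rw [← Real.rpow_add hr]; simp
  nlinarith

theorem crossWeight_mul (hr : 0 < r) : crossWeight θ r * r = rate θ r := by
  rw [crossWeight, rate, min_mul_of_nonneg _ _ hr.le, ← Real.rpow_add_one hr.ne',
    ← Real.rpow_add_one hr.ne']
  congr 2 <;> ring

theorem rate_le : rate θ r ≤ r ^ (2 * θ) := min_le_left _ _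

theorem crossWeight_mul_rpow_le (hr : 0 < r) : crossWeight θ r * r ^ (2 * θ) ≤ r := by
  have h : crossWeight θ r ≤ r ^ (1 - 2 * θ) := min_le_right _ _
  calc crossWeight θ r * r ^ (2 * θ) ≤ r ^ (1 - 2 * θ) * r ^ (2 * θ) := by gcongr
    _ = r := by rw [← Real.rpow_add hr]; simp

/-- The real inner product of two complex numbers. -/
def dotp (x y : ℂ) : ℝ := x.re * y.re + x.im * y.im

theorem dotp_self (x : ℂ) : dotp x x = ‖x‖ ^ 2 := by
  rw [← Complex.normSq_eq_norm_sq, Complex.normSq_apply, dotp]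

theorem dotp_sq_le (x y : ℂ) : dotp x y ^ 2 ≤ ‖x‖ ^ 2 * ‖y‖ ^ 2 := by
  rw [← dotp_self, ← dotp_self, dotp, dotp, dotp]
  nlinarith [sq_nonneg (x.re * y.im - x.im * y.re)]

theorem abs_dotp_le (x y : ℂ) : |dotp x y| ≤ (‖x‖ ^ 2 + ‖y‖ ^ 2) / 2 := by
  rw [← dotp_self, ← dotp_self, dotp, dotp, dotp, abs_le]
  constructor <;> nlinarith [sq_nonneg (x.re + y.re), sq_nonneg (x.im + y.im),
    sq_nonneg (x.re - y.re), sq_nonneg (x.im - y.im)]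

/-- The density of the Lyapunov functional: the energy, perturbed by a cross term which makes the
potential part of the energy dissipate as well. -/
noncomputable def lyapunov (lam ε θ r : ℝ) (x y : ℂ) : ℝ :=
  (‖y‖ ^ 2 + lam * ‖x‖ ^ 2) / 2 + ε * (crossWeight θ r * dotp x y)

variable {lam ε : ℝ}

theorem abs_cross_le (hr : 0 < r) (hε : 0 < ε) (hε₁ : ε ≤ 1 / 2) (hε₂ : ε ≤ lam / 2) (x y : ℂ) :
    |ε * (crossWeight θ r * dotp x y)| ≤ (‖y‖ ^ 2 + lam * ‖x‖ ^ 2) / 4 := by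
  have h1 := abs_dotp_le x y
  have h2 := crossWeight_le_one (θ := θ) hr
  have h3 := crossWeight_pos (θ := θ) hr
  rw [abs_mul, abs_mul, abs_of_pos hε, abs_of_pos h3]
  have h4 : crossWeight θ r * |dotp x y| ≤ (‖x‖ ^ 2 + ‖y‖ ^ 2) / 2 := by
    nlinarith [abs_nonneg (dotp x y)]
  nlinarith [sq_nonneg ‖x‖, sq_nonneg ‖y‖]

theorem lyapunov_le (hr : 0 < r) (hε : 0 < ε) (hε₁ : ε ≤ 1 / 2) (hε₂ : ε ≤ lam / 2) (x y : ℂ) :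
    lyapunov lam ε θ r x y ≤ ‖y‖ ^ 2 + lam * ‖x‖ ^ 2 := by
  have h := (abs_le.1 (abs_cross_le (θ := θ) hr hε hε₁ hε₂ x y)).2
  have : 0 ≤ ‖y‖ ^ 2 + lam * ‖x‖ ^ 2 := by
    have : 0 ≤ lam := by linarith
    positivity
  unfold lyapunov
  linarith

theorem le_lyapunov (hr : 0 < r) (hε : 0 < ε) (hε₁ : ε ≤ 1 / 2) (hε₂ : ε ≤ lam / 2) (x y : ℂ) :
    (‖y‖ ^ 2 + lam * ‖x‖ ^ 2) / 4 ≤ lyapunov lam ε θ r x y := by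
  have h := (abs_le.1 (abs_cross_le (θ := θ) hr hε hε₁ hε₂ x y)).1
  unfold lyapunov
  linarith

/-- The left-hand side is the derivative of the Lyapunov density along `x' = r y`,
`y' = -lam r x - r^(2θ) y`, after the cancellation of the conservative terms. -/
theorem lyapunov_dissipation (hr : 0 < r) (hlam : 0 < lam) (hε : 0 < ε) (hε₁ : ε ≤ 1 / 2)
    (hε₂ : ε ≤ lam / 2) (hε₃ : ε * (2 * lam + 1) ≤ lam) (x y : ℂ) :
    -(r ^ (2 * θ) * ‖y‖ ^ 2) + ε * (crossWeight θ r * (r * ‖y‖ ^ 2 - lam * (r * ‖x‖ ^ 2) -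
      r ^ (2 * θ) * dotp x y)) ≤ -(ε / 2 * rate θ r * lyapunov lam ε θ r x y) := by
  have hk := rate_pos (θ := θ) hr
  have hη := crossWeight_pos (θ := θ) hr
  have hηr := crossWeight_mul (θ := θ) hr
  have hkD : rate θ r ≤ r ^ (2 * θ) := rate_le
  have hηD := crossWeight_mul_rpow_le (θ := θ) hr
  have hL := lyapunov_le (θ := θ) hr hε hε₁ hε₂ x y
  have hp := dotp_sq_le x y
  set D := r ^ (2 * θ) with hD
  have hD0 : 0 < D := by positivity
  set η := crossWeight θ r
  set κ := rate θ r
  set p := dotp x y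
  set A := ‖x‖ ^ 2 with hA
  set B := ‖y‖ ^ 2 with hB
  have hA0 : 0 ≤ A := by positivity
  have hB0 : 0 ≤ B := by positivity
  have h1 : |η * D * p| ≤ (κ * lam * A + D * B / lam) / 2 := by
    apply abs_le_of_sq_le_sq _ (by positivity)
    have e1 : (η * D) ^ 2 ≤ κ * D := by
      rw [← hηr]
      nlinarith [mul_le_mul_of_nonneg_left hηD (mul_pos hη hD0).le]
    calc (η * D * p) ^ 2 = (η * D) ^ 2 * p ^ 2 := by ring
      _ ≤ (κ * D) * (A * B) := by gcongr
      _ = (κ * lam * A) * (D * B / lam) := by field_simp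
      _ ≤ ((κ * lam * A + D * B / lam) / 2) ^ 2 := by
        nlinarith [sq_nonneg (κ * lam * A - D * B / lam)]
  have h2 := (abs_le.1 h1).1
  have h3 : ε * (D * B / lam) / 2 + ε * D * B ≤ D * B / 2 := by
    have : (ε / lam / 2 + ε) ≤ 1 / 2 := by
      have e : ε / lam / 2 + ε = ε * (2 * lam + 1) / (2 * lam) := by field_simp; ring
      rw [e, div_le_div_iff₀ (by positivity) (by norm_num)]
      linarith
    calc ε * (D * B / lam) / 2 + ε * D * B = (ε / lam / 2 + ε) * (D * B) := by ring
      _ ≤ 1 / 2 * (D * B) := by gcongr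
      _ = _ := by ring
  have h4 : κ * B ≤ D * B := by gcongr
  have h5 : ε / 2 * κ * lyapunov lam ε θ r x y ≤ ε / 2 * κ * (B + lam * A) := by gcongr
  have h6 : ε * (κ * B) ≤ 1 / 2 * (κ * B) := by gcongr
  have h7 : ε * (-(η * D * p)) ≤ ε * ((κ * lam * A + D * B / lam) / 2) := by
    gcongr; linarith
  have h8 : ε * (κ * B) ≤ ε * (D * B) := by gcongr
  have e : -(D * B) + ε * (η * (r * B - lam * (r * A) - D * p)) =
      -(D * B) + ε * (κ * B) - ε * (κ * lam * A) + ε * (-(η * D * p)) := by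
    rw [← hηr]; ring
  rw [e]
  nlinarith [h2, h3, h4, h5, h6, h7, h8, mul_pos hε hk]

end Scalar

/-! ### The Lyapunov functional on a set of frequencies -/

/-- `c` is the integral of the integrable function `F`. -/
def HasIntegral (F : R3 → ℝ) (c : ℝ) : Prop := Integrable F ∧ ∫ ξ, F ξ = c

theorem HasIntegral.add {F G : R3 → ℝ} {c d : ℝ} (hF : HasIntegral F c) (hG : HasIntegral G d) :
    HasIntegral (fun ξ => F ξ + G ξ) (c + d) :=
  ⟨hF.1.add hG.1, by rw [integral_add hF.1 hG.1, hF.2, hG.2]⟩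

theorem HasIntegral.const_mul {F : R3 → ℝ} {c : ℝ} (hF : HasIntegral F c) (k : ℝ) :
    HasIntegral (fun ξ => k * F ξ) (k * c) :=
  ⟨hF.1.const_mul k, by rw [integral_const_mul, hF.2]⟩

theorem HasIntegral.congr {F G : R3 → ℝ} {c : ℝ} (hF : HasIntegral F c) (h : F =ᵐ[volume] G) :
    HasIntegral G c :=
  ⟨hF.1.congr h, by rw [← integral_congr_ae h, hF.2]⟩

theorem hasIntegral_inner (f g : L2) :
    HasIntegral (fun ξ => dotp (f ξ) (g ξ)) (RCLike.re (inner ℂ f g)) := by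
  have h := L2.integrable_inner (𝕜 := ℂ) f g
  have e : (fun ξ => RCLike.re (inner ℂ (f ξ) (g ξ))) = fun ξ => dotp (f ξ) (g ξ) := by
    ext ξ
    simp [dotp]
    ring
  refine ⟨?_, ?_⟩
  · rw [← e]; exact h.re
  · rw [← e, L2.inner_def, integral_re h]

theorem hasDerivAt_intervalIntegral {X : ℝ → L2} (hX : ContinuousOn X (Set.Ici 0)) {t : ℝ}
    (ht : 0 < t) : HasDerivAt (fun t => ∫ τ in (0 : ℝ)..t, X τ) (X t) t :=
  intervalIntegral.integral_hasDerivAt_right (intervalIntegrable_of_continuousOn_Ici hX ht.le)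
    ((hX.mono Set.Ioi_subset_Ici_self).stronglyMeasurableAtFilter isOpen_Ioi t ht)
    (hX.continuousAt (Ici_mem_nhds ht))

section Functional

variable {lam θ : ℝ} {V W : ℝ → L2} {N q : ℝ}

/-- The frequencies in an annulus at which the decay rate is at least `q`. -/
def rateSet (θ N q : ℝ) : Set R3 := {ξ | N⁻¹ ≤ rad ξ ∧ rad ξ ≤ N ∧ q ≤ rate θ (rad ξ)}

theorem measurable_rate (θ : ℝ) : Measurable fun ξ => rate θ (rad ξ) :=
  (measurable_rad.pow_const _).min (measurable_rad.pow_const _)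

theorem measurable_crossWeight (θ : ℝ) : Measurable fun ξ => crossWeight θ (rad ξ) :=
  (measurable_rad.pow_const _).min (measurable_rad.pow_const _)

theorem measurableSet_rateSet : MeasurableSet (rateSet θ N q) :=
  (measurableSet_le measurable_const measurable_rad).inter
    ((measurableSet_le measurable_rad measurable_const).inter
      (measurableSet_le measurable_const (measurable_rate θ)))

theorem memLp_indicator {B : Set R3} (hB : MeasurableSet B) {μ : R3 → ℝ} (hμ : Measurable μ) (C : ℝ)
    (h : ∀ ξ ∈ B, |μ ξ| ≤ C) : MemLp (fun ξ => ((B.indicator μ ξ : ℝ) : ℂ)) ⊤ volume :=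
  memLp_top_of_abs_le (hμ.indicator hB) (max C 0) fun ξ => by
    by_cases hξ : ξ ∈ B
    · rw [Set.indicator_of_mem hξ]; exact (h ξ hξ).trans (le_max_left _ _)
    · rw [Set.indicator_of_notMem hξ]; simp

/-- On a set of frequencies where the multipliers of the equation are bounded, the Volterra form of
the equation is a differential equation in `L²`, and the Lyapunov functional can be
differentiated. -/
theorem IsMode.setIntegral_lyapunov_le (h : IsMode lam θ V W) (hθ : 0 ≤ θ) (hlam : 0 < lam) {ε : ℝ}
    (hε : 0 < ε) (hε₁ : ε ≤ 1 / 2) (hε₂ : ε ≤ lam / 2) (hε₃ : ε * (2 * lam + 1) ≤ lam)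
    (hN : 0 < N) {B : Set R3} (hB : MeasurableSet B) (hBs : B ⊆ rateSet θ N q) :
    (∀ t, 0 ≤ t → IntegrableOn (fun ξ => lyapunov lam ε θ (rad ξ) (V t ξ) (W t ξ)) B) ∧
    ∀ t, 0 ≤ t → ∫ ξ in B, lyapunov lam ε θ (rad ξ) (V t ξ) (W t ξ) ≤
      Real.exp (-(ε / 2 * q * t)) * ∫ ξ in B, lyapunov lam ε θ (rad ξ) (V 0 ξ) (W 0 ξ) := by
  have hpos : ∀ ξ ∈ B, 0 < rad ξ := fun ξ hξ => (inv_pos.2 hN).trans_le (hBs hξ).1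
  have m1 : MemLp (fun ξ => ((B.indicator (fun _ => (1 : ℝ)) ξ : ℝ) : ℂ)) ⊤ volume :=
    memLp_indicator hB measurable_const 1 (by simp)
  have mr : MemLp (fun ξ => ((B.indicator rad ξ : ℝ) : ℂ)) ⊤ volume :=
    memLp_indicator hB measurable_rad N fun ξ hξ => by
      rw [abs_of_nonneg (rad_nonneg ξ)]; exact (hBs hξ).2.1
  have md : MemLp (fun ξ => ((B.indicator (fun ξ => rad ξ ^ (2 * θ)) ξ : ℝ) : ℂ)) ⊤ volume :=
    memLp_indicator hB (measurable_rad.pow_const _) (N ^ (2 * θ)) fun ξ hξ => by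
      rw [abs_of_nonneg (Real.rpow_nonneg (rad_nonneg ξ) _)]
      exact Real.rpow_le_rpow (rad_nonneg ξ) (hBs hξ).2.1 (by positivity)
  have mc : MemLp (fun ξ => ((B.indicator (fun ξ => crossWeight θ (rad ξ)) ξ : ℝ) : ℂ)) ⊤ volume :=
    memLp_indicator hB (measurable_crossWeight θ) 1 fun ξ hξ => by
      rw [abs_of_pos (crossWeight_pos (hpos ξ hξ))]
      exact crossWeight_le_one (hpos ξ hξ)
  set f : ℝ → L2 := fun t => mulL m1 (V t) with hf
  set g : ℝ → L2 := fun t => mulL m1 (W t) with hg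
  set f' : ℝ → L2 := fun t => mulL mr (W t) with hf'
  set g' : ℝ → L2 := fun t => -((lam : ℂ) • mulL mr (V t)) - mulL md (W t) with hg'
  set E : ℝ → ℝ := fun t => 1 / 2 * (RCLike.re (inner ℂ (g t) (g t)) +
    lam * RCLike.re (inner ℂ (f t) (f t))) + ε * RCLike.re (inner ℂ (f t) (mulL mc (g t))) with hE
  have cf : ContinuousOn f (Set.Ici 0) := (mulL m1).continuous.comp_continuousOn h.continuousOn_left
  have cg : ContinuousOn g (Set.Ici 0) := (mulL m1).continuous.comp_continuousOn h.continuousOn_right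
  have cE : ContinuousOn E (Set.Ici 0) := by
    have c1 := (cg.inner (𝕜 := ℂ) cg)
    have c2 := (cf.inner (𝕜 := ℂ) cf)
    have c3 := (cf.inner (𝕜 := ℂ) ((mulL mc).continuous.comp_continuousOn cg))
    exact (continuousOn_const.mul ((RCLike.continuous_re.comp_continuousOn c1).add
      (continuousOn_const.mul (RCLike.continuous_re.comp_continuousOn c2)))).add
      (continuousOn_const.mul (RCLike.continuous_re.comp_continuousOn c3))
  have dI {X : ℝ → L2} (hX : ContinuousOn X (Set.Ici 0)) (T : L2 →L[ℂ] L2) {t : ℝ} (ht : 0 < t) :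
      HasDerivAt (fun t => T (∫ τ in (0 : ℝ)..t, X τ)) (T (X t)) t :=
    (T.restrictScalars ℝ).hasFDerivAt.comp_hasDerivAt t (hasDerivAt_intervalIntegral hX ht)
  have df : ∀ t, 0 < t → HasDerivAt f (f' t) t := fun t ht => by
    refine ((dI h.continuousOn_right (mulL mr) ht).const_add (f 0)).congr_of_eventuallyEq ?_
    filter_upwards [Ioi_mem_nhds ht] with τ hτ
    apply Lp.ext
    filter_upwards [Lp.coeFn_add (f 0) (mulL mr (∫ τ in (0 : ℝ)..τ, W τ)), h.left τ (le_of_lt hτ),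
      mulL_coeFn m1 (V τ), mulL_coeFn m1 (V 0), mulL_coeFn mr (∫ τ in (0 : ℝ)..τ, W τ)]
      with ξ h1 h2 h3 h4 h5
    rw [h1, Pi.add_apply, h5, hf, h3, h4, h2]
    by_cases hξ : ξ ∈ B <;> simp [hξ]
  have dg : ∀ t, 0 < t → HasDerivAt g (g' t) t := fun t ht => by
    have d1 : HasDerivAt (fun t => g 0 - (lam : ℂ) • mulL mr (∫ τ in (0 : ℝ)..t, V τ) -
        mulL md (∫ τ in (0 : ℝ)..t, W τ)) (g' t) t :=
      (((hasDerivAt_const t (g 0)).sub ((dI h.continuousOn_left (mulL mr) ht).const_smul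
        (lam : ℂ))).sub (dI h.continuousOn_right (mulL md) ht)).congr_deriv (by simp [hg'])
    refine d1.congr_of_eventuallyEq ?_
    filter_upwards [Ioi_mem_nhds ht] with τ hτ
    apply Lp.ext
    filter_upwards [Lp.coeFn_sub (g 0 - (lam : ℂ) • mulL mr (∫ τ in (0 : ℝ)..τ, V τ))
        (mulL md (∫ τ in (0 : ℝ)..τ, W τ)),
      Lp.coeFn_sub (g 0) ((lam : ℂ) • mulL mr (∫ τ in (0 : ℝ)..τ, V τ)),
      Lp.coeFn_smul (lam : ℂ) (mulL mr (∫ τ in (0 : ℝ)..τ, V τ)), h.right τ (le_of_lt hτ),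
      mulL_coeFn m1 (W τ), mulL_coeFn m1 (W 0), mulL_coeFn mr (∫ τ in (0 : ℝ)..τ, V τ),
      mulL_coeFn md (∫ τ in (0 : ℝ)..τ, W τ)]
      with ξ h1 h2 h3 h4 h5 h6 h7 h8
    rw [h1, Pi.sub_apply, h2, Pi.sub_apply, h3, Pi.smul_apply, h7, h8, hg, h5, h6, h4, smul_eq_mul]
    by_cases hξ : ξ ∈ B <;> simp [hξ]
  -- The pointwise values of all the functions involved, on `B` and off `B`.
  have vals : ∀ t, ∀ᵐ ξ : R3,
      (ξ ∈ B → f t ξ = V t ξ ∧ g t ξ = W t ξ ∧ f' t ξ = rad ξ * W t ξ ∧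
        g' t ξ = -(lam * (rad ξ * V t ξ)) - ((rad ξ ^ (2 * θ) : ℝ) : ℂ) * W t ξ ∧
        mulL mc (g t) ξ = crossWeight θ (rad ξ) * W t ξ ∧
        mulL mc (g' t) ξ = crossWeight θ (rad ξ) *
          (-(lam * (rad ξ * V t ξ)) - ((rad ξ ^ (2 * θ) : ℝ) : ℂ) * W t ξ)) ∧
      (ξ ∉ B → f t ξ = 0 ∧ g t ξ = 0 ∧ mulL mc (g t) ξ = 0 ∧ mulL mc (g' t) ξ = 0) := fun t => by
    filter_upwards [mulL_coeFn m1 (V t), mulL_coeFn m1 (W t), mulL_coeFn mr (W t),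
      mulL_coeFn mr (V t), mulL_coeFn md (W t), mulL_coeFn mc (g t), mulL_coeFn mc (g' t),
      Lp.coeFn_sub (-((lam : ℂ) • mulL mr (V t))) (mulL md (W t)),
      Lp.coeFn_neg ((lam : ℂ) • mulL mr (V t)), Lp.coeFn_smul (lam : ℂ) (mulL mr (V t))]
      with ξ h1 h2 h3 h4 h5 h6 h7 h8 h9 h10
    rw [Pi.sub_apply, h9, Pi.neg_apply, h10, Pi.smul_apply, h4, h5, smul_eq_mul] at h8
    refine ⟨fun hξ => ?_, fun hξ => ?_⟩
    · have hg1 : g' t ξ = -(lam * (rad ξ * V t ξ)) - ((rad ξ ^ (2 * θ) : ℝ) : ℂ) * W t ξ := by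
        rw [hg', h8]; simp [hξ]
      have hg2 : g t ξ = W t ξ := by rw [hg, h2]; simp [hξ]
      refine ⟨by rw [hf, h1]; simp [hξ], hg2, by rw [hf', h3]; simp [hξ], hg1, ?_, ?_⟩
      · rw [h6, hg2]; simp [hξ]
      · rw [h7, hg1]; simp [hξ]
    · refine ⟨by rw [hf, h1]; simp [hξ], by rw [hg, h2]; simp [hξ], by rw [h6]; simp [hξ],
        by rw [h7]; simp [hξ]⟩
  have hEint : ∀ t, HasIntegral
      (B.indicator fun ξ => lyapunov lam ε θ (rad ξ) (V t ξ) (W t ξ)) (E t) := fun t => by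
    refine ((((hasIntegral_inner (g t) (g t)).add ((hasIntegral_inner (f t) (f t)).const_mul
      lam)).const_mul (1 / 2)).add ((hasIntegral_inner (f t) (mulL mc (g t))).const_mul ε)).congr ?_
    filter_upwards [vals t] with ξ hv
    by_cases hξ : ξ ∈ B
    · obtain ⟨v1, v2, -, -, v5, -⟩ := hv.1 hξ
      rw [Set.indicator_of_mem hξ, v1, v2, v5, dotp_self, dotp_self]
      simp only [lyapunov, dotp, Complex.mul_re, Complex.mul_im, Complex.ofReal_re,
        Complex.ofReal_im]
      ring
    · obtain ⟨v1, v2, v3, -⟩ := hv.2 hξ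
      rw [Set.indicator_of_notMem hξ, v1, v2, v3]
      simp [dotp]
  have dE : ∀ t, 0 < t → ∃ e, HasDerivAt E e t ∧ e ≤ -(ε / 2 * q * E t) := fun t ht => by
    have re {F : ℝ → ℂ} {z : ℂ} (hF : HasDerivAt F z t) :
        HasDerivAt (fun t => RCLike.re (F t)) (RCLike.re z) t :=
      Complex.reCLM.hasFDerivAt.comp_hasDerivAt t hF
    have dmg : HasDerivAt (fun t => mulL mc (g t)) (mulL mc (g' t)) t :=
      ((mulL mc).restrictScalars ℝ).hasFDerivAt.comp_hasDerivAt t (dg t ht)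
    have d1 := re ((dg t ht).inner ℂ (dg t ht))
    have d2 := re ((df t ht).inner ℂ (df t ht))
    have d3 := re ((df t ht).inner ℂ dmg)
    refine ⟨_, ((d1.add (d2.const_mul lam)).const_mul (1 / 2)).add (d3.const_mul ε), ?_⟩
    simp only [map_add]
    have hi := ((((hasIntegral_inner (g t) (g' t)).add (hasIntegral_inner (g' t) (g t))).add
      (((hasIntegral_inner (f t) (f' t)).add (hasIntegral_inner (f' t) (f t))).const_mul
        lam)).const_mul (1 / 2)).add (((hasIntegral_inner (f t) (mulL mc (g' t))).add
        (hasIntegral_inner (f' t) (mulL mc (g t)))).const_mul ε)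
    have hj := (hEint t).const_mul (-(ε / 2 * q))
    rw [← hi.2, ← neg_mul, ← hj.2]
    refine integral_mono_ae hi.1 hj.1 ?_
    filter_upwards [vals t] with ξ hv
    by_cases hξ : ξ ∈ B
    · obtain ⟨v1, v2, v3, v4, v5, v6⟩ := hv.1 hξ
      simp only [Set.indicator_of_mem hξ, v1, v2, v3, v4, v5, v6]
      have hd := lyapunov_dissipation (θ := θ) (hpos ξ hξ) hlam hε hε₁ hε₂ hε₃ (V t ξ) (W t ξ)
      have hL : 0 ≤ lyapunov lam ε θ (rad ξ) (V t ξ) (W t ξ) :=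
        le_trans (by positivity) (le_lyapunov (θ := θ) (hpos ξ hξ) hε hε₁ hε₂ _ _)
      have hq' : ε / 2 * q * lyapunov lam ε θ (rad ξ) (V t ξ) (W t ξ) ≤
          ε / 2 * rate θ (rad ξ) * lyapunov lam ε θ (rad ξ) (V t ξ) (W t ξ) := by
        have := (hBs hξ).2.2
        gcongr
      rw [neg_mul]
      refine le_trans (le_of_eq ?_) (hd.trans (neg_le_neg hq'))
      rw [← dotp_self, ← dotp_self]
      simp only [dotp, Complex.mul_re, Complex.mul_im, Complex.ofReal_re, Complex.ofReal_im,
        Complex.sub_re, Complex.sub_im, Complex.neg_re, Complex.neg_im]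
      ring
    · obtain ⟨v1, v2, v3, v4⟩ := hv.2 hξ
      simp only [Set.indicator_of_notMem hξ, v1, v2, v3, v4]
      simp [dotp]
  have hset : ∀ t, E t = ∫ ξ in B, lyapunov lam ε θ (rad ξ) (V t ξ) (W t ξ) := fun t => by
    rw [← (hEint t).2, integral_indicator hB]
  refine ⟨fun t _ => (integrable_indicator_iff hB).1 (hEint t).1, fun t ht => ?_⟩
  rw [← hset, ← hset]
  have anti : AntitoneOn (fun t => Real.exp (ε / 2 * q * t) * E t) (Set.Ici 0) := by
    have hd : ∀ t ∈ interior (Set.Ici (0 : ℝ)), ∃ e, HasDerivAt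
        (fun t => Real.exp (ε / 2 * q * t) * E t) e t ∧ e ≤ 0 := fun t ht => by
      rw [interior_Ici] at ht
      obtain ⟨e, he, hle⟩ := dE t ht
      have d1 : HasDerivAt (fun t => Real.exp (ε / 2 * q * t))
          (Real.exp (ε / 2 * q * t) * (ε / 2 * q)) t := by
        simpa using ((hasDerivAt_id t).const_mul (ε / 2 * q)).exp
      refine ⟨_, d1.mul he, ?_⟩
      have := mul_le_mul_of_nonneg_left hle (Real.exp_pos (ε / 2 * q * t)).le
      linarith
    refine antitoneOn_of_deriv_nonpos (convex_Ici 0) ?_ (fun t ht => ?_) (fun t ht => ?_)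
    · exact (Continuous.continuousOn (by fun_prop)).mul cE
    · obtain ⟨e, he, -⟩ := hd t ht
      exact he.differentiableAt.differentiableWithinAt
    · obtain ⟨e, he, hle⟩ := hd t ht
      rw [he.deriv]; exact hle
  have h1 := anti (Set.mem_Ici.2 le_rfl) (Set.mem_Ici.2 ht) ht
  simp only [mul_zero, Real.exp_zero, one_mul] at h1
  rw [Real.exp_neg, ← div_eq_inv_mul, le_div_iff₀ (Real.exp_pos _), mul_comm]
  exact h1

end Functional

/-! ### Pointwise decay in frequency space -/

theorem IsMode.ae_lyapunov_le {lam θ : ℝ} {V W : ℝ → L2} (h : IsMode lam θ V W) (hθ : 0 ≤ θ)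
    (hlam : 0 < lam) {ε : ℝ} (hε : 0 < ε) (hε₁ : ε ≤ 1 / 2) (hε₂ : ε ≤ lam / 2)
    (hε₃ : ε * (2 * lam + 1) ≤ lam) {t : ℝ} (ht : 0 ≤ t) :
    ∀ᵐ ξ : R3, lyapunov lam ε θ (rad ξ) (V t ξ) (W t ξ) ≤
      Real.exp (-(ε / 4 * rate θ (rad ξ) * t)) *
        lyapunov lam ε θ (rad ξ) (V 0 ξ) (W 0 ξ) := by
  have key : ∀ (n : ℕ) (q : ℚ), ∀ᵐ ξ : R3, ξ ∈ rateSet θ (n + 1) q →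
      lyapunov lam ε θ (rad ξ) (V t ξ) (W t ξ) ≤
        Real.exp (-(ε / 2 * q * t)) * lyapunov lam ε θ (rad ξ) (V 0 ξ) (W 0 ξ) := fun n q => by
    have hN : (0 : ℝ) < n + 1 := by positivity
    have hS := measurableSet_rateSet (θ := θ) (N := (n : ℝ) + 1) (q := q)
    have h1 := (h.setIntegral_lyapunov_le hθ hlam hε hε₁ hε₂ hε₃ hN hS subset_rfl).1
    rw [← ae_restrict_iff' hS]
    refine ae_le_of_forall_setIntegral_le (h1 t ht) ((h1 0 le_rfl).const_mul _) fun s hs _ => ?_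
    rw [Measure.restrict_restrict hs, integral_const_mul]
    exact (h.setIntegral_lyapunov_le hθ hlam hε hε₁ hε₂ hε₃ hN (hs.inter hS)
      Set.inter_subset_right).2 t ht
  filter_upwards [ae_all_iff.2 fun n => ae_all_iff.2 (key n), ae_ne_zero] with ξ hξ h0
  have hr := rad_pos h0
  have hk := rate_pos (θ := θ) hr
  obtain ⟨n, hn⟩ := exists_nat_ge (max (rad ξ) (rad ξ)⁻¹)
  -- The loss of a factor two in the rate makes room for a rational number.
  obtain ⟨q, hq1, hq2⟩ := exists_rat_btwn (half_lt_self hk)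
  have hL : 0 ≤ lyapunov lam ε θ (rad ξ) (V 0 ξ) (W 0 ξ) :=
    le_trans (by positivity) (le_lyapunov (θ := θ) hr hε hε₁ hε₂ _ _)
  refine (hξ n q ⟨?_, ?_, hq2.le⟩).trans ?_
  · exact inv_le_of_inv_le₀ hr (by linarith [le_max_right (rad ξ) (rad ξ)⁻¹])
  · linarith [le_max_left (rad ξ) (rad ξ)⁻¹]
  · have : ε / 4 * rate θ (rad ξ) * t ≤ ε / 2 * q * t := by
      have : ε / 4 * rate θ (rad ξ) ≤ ε / 2 * q := by nlinarith
      gcongr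
    gcongr

theorem exists_mode_decay {lam θ : ℝ} (hθ : 0 ≤ θ) (hlam : 0 < lam) :
    ∃ C c : ℝ, 0 < C ∧ 0 < c ∧ ∀ V W : ℝ → L2, IsMode lam θ V W → ∀ t, 0 ≤ t → ∀ᵐ ξ : R3,
      ‖V t ξ‖ ≤ C * Real.exp (-(c * rate θ (rad ξ) * t)) * (‖V 0 ξ‖ + ‖W 0 ξ‖) ∧
      ‖W t ξ‖ ≤ C * Real.exp (-(c * rate θ (rad ξ) * t)) * (‖V 0 ξ‖ + ‖W 0 ξ‖) := by
  set ε := lam / (4 * (lam + 1)) with hεdef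
  have hε : 0 < ε := by positivity
  have he : ε * (4 * (lam + 1)) = lam := by rw [hεdef]; field_simp
  have hε₁ : ε ≤ 1 / 2 := by nlinarith
  have hε₂ : ε ≤ lam / 2 := by nlinarith
  have hε₃ : ε * (2 * lam + 1) ≤ lam := by nlinarith
  -- `K` compares the energy density with the sum of squares from both sides.
  set K := 4 * (1 + lam) * (1 + lam⁻¹) with hK
  have hK0 : 0 < K := by positivity
  refine ⟨√K, ε / 8, by positivity, by positivity, fun V W h t ht => ?_⟩
  filter_upwards [h.ae_lyapunov_le hθ hlam hε hε₁ hε₂ hε₃ ht, ae_ne_zero] with ξ hξ h0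
  have hr := rad_pos h0
  have h1 := le_lyapunov (θ := θ) hr hε hε₁ hε₂ (V t ξ) (W t ξ)
  have h2 := lyapunov_le (θ := θ) hr hε hε₁ hε₂ (V 0 ξ) (W 0 ξ)
  set X := Real.exp (-(ε / 8 * rate θ (rad ξ) * t)) with hX
  have hXX : Real.exp (-(ε / 4 * rate θ (rad ξ) * t)) = X ^ 2 := by
    rw [hX, ← Real.exp_nat_mul]
    congr 1
    push_cast
    ring
  rw [hXX] at hξ
  set S := ‖V 0 ξ‖ + ‖W 0 ξ‖ with hS
  have hS0 : 0 ≤ S := by positivity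
  have h3 : ‖W t ξ‖ ^ 2 + lam * ‖V t ξ‖ ^ 2 ≤ 4 * (1 + lam) * (X ^ 2 * S ^ 2) := by
    have e1 : ‖W 0 ξ‖ ^ 2 + lam * ‖V 0 ξ‖ ^ 2 ≤ (1 + lam) * S ^ 2 := by
      have a1 := norm_nonneg (V 0 ξ)
      have a2 := norm_nonneg (W 0 ξ)
      have : S ^ 2 = ‖V 0 ξ‖ ^ 2 + 2 * (‖V 0 ξ‖ * ‖W 0 ξ‖) + ‖W 0 ξ‖ ^ 2 := by rw [hS]; ring
      nlinarith [mul_nonneg a1 a2, mul_nonneg hlam.le (mul_nonneg a1 a2), sq_nonneg ‖V 0 ξ‖,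
        mul_nonneg hlam.le (sq_nonneg ‖W 0 ξ‖)]
    have := mul_le_mul_of_nonneg_left (h2.trans e1) (sq_nonneg X)
    linarith
  have hb : (√K * X * S) ^ 2 = K * (X ^ 2 * S ^ 2) := by
    rw [mul_pow, mul_pow, Real.sq_sqrt hK0.le]; ring
  have hp : 0 ≤ √K * X * S := by positivity
  have hXS : 0 ≤ X ^ 2 * S ^ 2 := by positivity
  have hli : 0 < lam⁻¹ := by positivity
  refine ⟨abs_le_of_sq_le_sq' ?_ hp |>.2, abs_le_of_sq_le_sq' ?_ hp |>.2⟩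
  · rw [hb]
    have e : ‖V t ξ‖ ^ 2 = lam⁻¹ * (lam * ‖V t ξ‖ ^ 2) := by field_simp
    rw [e]
    calc lam⁻¹ * (lam * ‖V t ξ‖ ^ 2) ≤ lam⁻¹ * (4 * (1 + lam) * (X ^ 2 * S ^ 2)) :=
          mul_le_mul_of_nonneg_left (by linarith [sq_nonneg ‖W t ξ‖]) hli.le
      _ ≤ (1 + lam⁻¹) * (4 * (1 + lam) * (X ^ 2 * S ^ 2)) := by gcongr; linarith
      _ = K * (X ^ 2 * S ^ 2) := by rw [hK]; ring
  · rw [hb]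
    have e2 : 0 ≤ lam * ‖V t ξ‖ ^ 2 := by positivity
    calc ‖W t ξ‖ ^ 2 ≤ 1 * (4 * (1 + lam) * (X ^ 2 * S ^ 2)) := by linarith
      _ ≤ (1 + lam⁻¹) * (4 * (1 + lam) * (X ^ 2 * S ^ 2)) := by gcongr; linarith
      _ = K * (X ^ 2 * S ^ 2) := by rw [hK]; ring

/-- A field is the sum of its transverse part and its longitudinal part, which are modes of speeds
`|a|` and `|b|`. -/
theorem exists_solution_decay {a b θ : ℝ} (ha : 0 < a ^ 2) (hb : 0 < b ^ 2) (hθ : 0 ≤ θ) :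
    ∃ C c : ℝ, 0 < C ∧ 0 < c ∧ ∀ (u₀ : Fin 3 → DistZ) (u₁ : Fin 3 → L2) (u : ℝ → Fin 3 → DistZ)
      (ut : ℝ → Fin 3 → L2), IsEnergySolution a b θ u₀ u₁ u ut → ∀ v : ℝ → Fin 3 → L2,
      (∀ k, ContinuousOn (fun t => v t k) (Set.Ici 0)) →
      (∀ k t, 0 ≤ t → riesz 1 (u t k) = ofL2 (v t k)) → ∀ t, 0 ≤ t → ∀ k, ∀ᵐ ξ : R3,
      ‖(𝓕 (v t k) : L2) ξ‖ ≤ C * Real.exp (-(c * rate θ (rad ξ) * t)) *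
        ∑ j, (‖(𝓕 (v 0 j) : L2) ξ‖ + ‖(𝓕 (ut 0 j) : L2) ξ‖) ∧
      ‖(𝓕 (ut t k) : L2) ξ‖ ≤ C * Real.exp (-(c * rate θ (rad ξ) * t)) *
        ∑ j, (‖(𝓕 (v 0 j) : L2) ξ‖ + ‖(𝓕 (ut 0 j) : L2) ξ‖) := by
  obtain ⟨C₁, c₁, hC₁, hc₁, h₁⟩ := exists_mode_decay hθ ha
  obtain ⟨C₂, c₂, hC₂, hc₂, h₂⟩ := exists_mode_decay hθ hb
  refine ⟨2 * C₁ + C₂, min c₁ c₂, by positivity, lt_min hc₁ hc₂, ?_⟩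
  intro u₀ u₁ u ut h v hvc hv t ht k
  set V : ℝ → Fin 3 → L2 := fun t k => 𝓕 (v t k) with hV
  set W : ℝ → Fin 3 → L2 := fun t k => 𝓕 (ut t k) with hW
  have cV : ∀ k, ContinuousOn (fun t => V t k) (Set.Ici 0) := fun k =>
    (Lp.fourierTransformₗᵢ R3 ℂ).continuous.comp_continuousOn (hvc k)
  have cW : ∀ k, ContinuousOn (fun t => W t k) (Set.Ici 0) := fun k =>
    (Lp.fourierTransformₗᵢ R3 ℂ).continuous.comp_continuousOn (h.continuousOn_ut k)
  have hl := fun k t (ht : 0 ≤ t) => h.left hv k ht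
  have hr := fun k t (ht : 0 ≤ t) => h.right hvc hv k ht
  have d₁ := h₁ _ _ (isMode_transverse (V := V) (W := W) (θ := θ) (a := a) (b := b) k cV cW hl hr)
    t ht
  have d₂ := h₂ _ _ (isMode_longitudinal (V := V) (W := W) (θ := θ) (a := a) (b := b) cV cW hl hr)
    t ht
  have bl : ∀ F : Fin 3 → L2, ∀ᵐ ξ : R3, ‖longitudinal F ξ‖ ≤ ∑ j, ‖F j ξ‖ := fun F => by
    filter_upwards [longitudinal_coeFn F] with ξ hξ
    rw [hξ]
    refine (norm_sum_le _ _).trans (Finset.sum_le_sum fun j _ => ?_)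
    rw [norm_mul, Complex.norm_real, Real.norm_eq_abs]
    exact mul_le_of_le_one_left (norm_nonneg _) (abs_dirCos_le j ξ)
  have bt : ∀ F : Fin 3 → L2, ∀ᵐ ξ : R3, ‖transverse k F ξ‖ ≤ 2 * ∑ j, ‖F j ξ‖ ∧
      ‖F k ξ‖ ≤ ‖transverse k F ξ‖ + ‖longitudinal F ξ‖ := fun F => by
    filter_upwards [transverse_coeFn k F, longitudinal_coeFn F, bl F] with ξ h1 h2 h3
    rw [← h2] at h1
    have h4 : ‖(dirCos k ξ : ℂ) * longitudinal F ξ‖ ≤ ‖longitudinal F ξ‖ := by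
      rw [norm_mul, Complex.norm_real, Real.norm_eq_abs]
      exact mul_le_of_le_one_left (norm_nonneg _) (abs_dirCos_le k ξ)
    have h5 : ‖F k ξ‖ ≤ ∑ j, ‖F j ξ‖ :=
      Finset.single_le_sum (f := fun j => ‖F j ξ‖) (fun j _ => norm_nonneg _) (Finset.mem_univ k)
    refine ⟨?_, ?_⟩
    · rw [h1]
      exact (norm_sub_le _ _).trans (by linarith)
    · have e : F k ξ = transverse k F ξ + (dirCos k ξ : ℂ) * longitudinal F ξ := by rw [h1]; ring
      calc ‖F k ξ‖ = ‖transverse k F ξ + (dirCos k ξ : ℂ) * longitudinal F ξ‖ := by rw [← e]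
        _ ≤ _ := (norm_add_le _ _).trans (by linarith)
  filter_upwards [d₁, d₂, bl (V 0), bl (W 0), bt (V 0), bt (W 0), bt (V t), bt (W t), ae_ne_zero]
    with ξ a₁ a₂ b₁ b₂ b₃ b₄ b₅ b₆ h0
  have hk := rate_pos (θ := θ) (rad_pos h0)
  rw [Finset.sum_add_distrib]
  have e₁ : Real.exp (-(c₁ * rate θ (rad ξ) * t)) ≤
      Real.exp (-(min c₁ c₂ * rate θ (rad ξ) * t)) := by
    gcongr; exact min_le_left _ _
  have e₂ : Real.exp (-(c₂ * rate θ (rad ξ) * t)) ≤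
      Real.exp (-(min c₁ c₂ * rate θ (rad ξ) * t)) := by
    gcongr; exact min_le_right _ _
  set X := Real.exp (-(min c₁ c₂ * rate θ (rad ξ) * t))
  set S := ∑ j, ‖V 0 j ξ‖ + ∑ j, ‖W 0 j ξ‖ with hS
  have hS0 : 0 ≤ S := by positivity
  have f₁ : C₁ * Real.exp (-(c₁ * rate θ (rad ξ) * t)) *
      (‖transverse k (V 0) ξ‖ + ‖transverse k (W 0) ξ‖) ≤ C₁ * X * (2 * S) := by
    gcongr; linarith [b₃.1, b₄.1]
  have f₂ : C₂ * Real.exp (-(c₂ * rate θ (rad ξ) * t)) *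
      (‖longitudinal (V 0) ξ‖ + ‖longitudinal (W 0) ξ‖) ≤ C₂ * X * S := by
    gcongr; linarith
  have f₃ : (2 * C₁ + C₂) * X * S = C₁ * X * (2 * S) + C₂ * X * S := by ring
  change ‖V t k ξ‖ ≤ (2 * C₁ + C₂) * X * S ∧ ‖W t k ξ‖ ≤ (2 * C₁ + C₂) * X * S
  rw [f₃]
  exact ⟨b₅.2.trans (add_le_add (a₁.1.trans f₁) (a₂.1.trans f₂)),
    b₆.2.trans (add_le_add (a₁.2.trans f₁) (a₂.2.trans f₂))⟩

/-! ### Low frequencies of functions in `L^m` -/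

theorem IsFunction.congr {f : DistZ} {h h' : R3 → ℂ} (hf : IsFunction f h) (e : h =ᵐ[volume] h') :
    IsFunction f h' := fun φ => by
  have e' : (fun x => h x * (φ : 𝓢(R3, ℂ)) x) =ᵐ[volume] fun x => h' x * (φ : 𝓢(R3, ℂ)) x := by
    filter_upwards [e] with x hx
    rw [hx]
  exact ⟨(hf φ).1.congr e', (hf φ).2.trans (integral_congr_ae e')⟩

theorem IsFunction.sub {f f' : DistZ} {h h' : R3 → ℂ} (hf : IsFunction f h)
    (hf' : IsFunction f' h') : IsFunction (f - f') (fun x => h x - h' x) := fun φ => by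
  simp_rw [sub_mul]
  refine ⟨(hf φ).1.sub (hf' φ).1, ?_⟩
  rw [integral_sub (hf φ).1 (hf' φ).1, ← (hf φ).2, ← (hf' φ).2]
  rfl

theorem isFunction_ofL2 (g : L2) : IsFunction (ofL2 g) g := fun φ => by
  refine ⟨integrable_memLp_two_mul (Lp.memLp g) _, ?_⟩
  rw [ofL2_apply]
  simp_rw [mul_comm]

theorem eLpNorm_two_sq (F : R3 → ℂ) : eLpNorm F 2 volume ^ 2 = ∫⁻ x, ‖F x‖ₑ ^ 2 := by
  have := eLpNorm_nnreal_pow_eq_lintegral (p := 2) (f := F) (μ := volume) two_ne_zero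
  simpa using this

theorem lintegral_enorm_sq_fourier (g : L2) :
    ∫⁻ ξ, ‖(𝓕 g : L2) ξ‖ₑ ^ 2 = ∫⁻ x, ‖g x‖ₑ ^ 2 := by
  rw [← eLpNorm_two_sq, ← eLpNorm_two_sq, eLpNorm_fourier]

/-- Truncation at height `Λ`: the number itself if its modulus is at most `Λ`, and `0` otherwise. -/
noncomputable def truncate (Λ : ℝ) (z : ℂ) : ℂ := if ‖z‖ ≤ Λ then z else 0

theorem measurable_truncate (Λ : ℝ) : Measurable (truncate Λ) :=
  Measurable.ite (measurableSet_le measurable_norm measurable_const) measurable_id measurable_const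

theorem enorm_truncate_sq_le {Λ m : ℝ} (hΛ : 0 < Λ) (hm₂ : m < 2) (z : ℂ) :
    ‖truncate Λ z‖ₑ ^ 2 ≤ ENNReal.ofReal (Λ ^ (2 - m)) * ENNReal.ofReal (‖z‖ ^ m) := by
  unfold truncate
  split_ifs with h
  · rw [← ENNReal.ofReal_mul (by positivity), ← ofReal_norm, ← ENNReal.ofReal_pow (norm_nonneg _)]
    apply ENNReal.ofReal_le_ofReal
    rcases eq_or_ne z 0 with rfl | hz
    · rw [norm_zero, zero_pow two_ne_zero]; positivity
    have hz' : 0 < ‖z‖ := norm_pos_iff.2 hz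
    calc ‖z‖ ^ 2 = ‖z‖ ^ (2 - m) * ‖z‖ ^ m := by
          rw [← Real.rpow_add hz', ← Real.rpow_natCast]; norm_num
      _ ≤ _ := by
          gcongr
  · simp

theorem enorm_sub_truncate_le {Λ m : ℝ} (hΛ : 0 < Λ) (hm₁ : 1 ≤ m) (z : ℂ) :
    ‖z - truncate Λ z‖ₑ ≤ ENNReal.ofReal (Λ ^ (1 - m)) * ENNReal.ofReal (‖z‖ ^ m) := by
  unfold truncate
  split_ifs with h
  · simp
  · rw [sub_zero, ← ENNReal.ofReal_mul (by positivity), ← ofReal_norm]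
    apply ENNReal.ofReal_le_ofReal
    push Not at h
    have hz' : 0 < ‖z‖ := hΛ.trans h
    calc ‖z‖ = ‖z‖ ^ (1 - m) * ‖z‖ ^ m := by rw [← Real.rpow_add hz']; norm_num
      _ ≤ _ := by
          gcongr ?_ * _
          exact Real.rpow_le_rpow_of_nonpos hΛ h.le (by linarith)

theorem volume_rad_le {R : ℝ} (hR : 0 < R) : volume {ξ : R3 | rad ξ ≤ R} =
    ENNReal.ofReal (R ^ 3) * volume (Metric.closedBall (0 : R3) (2 * Real.pi)⁻¹) := by
  have e : {ξ : R3 | rad ξ ≤ R} = Metric.closedBall 0 (R * (2 * Real.pi)⁻¹) := by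
    ext ξ
    simp only [Set.mem_ofPred_eq, mem_closedBall_zero_iff, rad]
    rw [← div_eq_mul_inv, le_div_iff₀ (by positivity), mul_comm]
  rw [e, Measure.addHaar_closedBall_mul _ _ hR.le (by positivity)]
  simp

theorem enorm_add_sq_le (z w : ℂ) : ‖z + w‖ₑ ^ 2 ≤ 2 * ‖z‖ₑ ^ 2 + 2 * ‖w‖ₑ ^ 2 := by
  have e : ∀ z : ℂ, ‖z‖ₑ ^ 2 = ENNReal.ofReal (‖z‖ ^ 2) := fun z => by
    rw [← ofReal_norm, ENNReal.ofReal_pow (norm_nonneg _)]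
  rw [e, e, e, ← ENNReal.ofReal_ofNat 2, ← ENNReal.ofReal_mul zero_le_two,
    ← ENNReal.ofReal_mul zero_le_two, ← ENNReal.ofReal_add (by positivity) (by positivity)]
  apply ENNReal.ofReal_le_ofReal
  nlinarith [norm_add_le z w, norm_nonneg (z + w), sq_nonneg (‖z‖ - ‖w‖)]

/-- A Bernstein inequality. The function is truncated at the height at which the bounds for the two
parts, an integrable function with bounded Fourier transform and a square integrable function, are
in balance; this takes the place of the Hausdorff–Young inequality. -/
theorem exists_lintegral_rad_le {m : ℝ} (hm₁ : 1 ≤ m) (hm₂ : m < 2) :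
    ∃ C : ℝ, 0 < C ∧ ∀ (f : DistZ) (G h : R3 → ℂ), HasFourier f G → IsFunction f h →
      MemLp h (ENNReal.ofReal m) volume → ∀ R : ℝ, 0 < R →
      ∫⁻ ξ in {ξ | rad ξ ≤ R}, ‖G ξ‖ₑ ^ 2 ≤ ENNReal.ofReal
        (C * R ^ (3 * (2 - m) / m) * (eLpNorm h (ENNReal.ofReal m) volume).toReal ^ 2) := by
  have hm0 : 0 < m := by linarith
  set ν := volume (Metric.closedBall (0 : R3) (2 * Real.pi)⁻¹) with hν
  have hν1 : ν ≠ ⊤ := measure_closedBall_lt_top.ne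
  refine ⟨2 * ν.toReal + 2, by positivity, fun f G h hG hf hh R hR => ?_⟩
  set A := (eLpNorm h (ENNReal.ofReal m) volume).toReal with hA
  have hp0 : ENNReal.ofReal m ≠ 0 := by simpa using hm0
  rcases (ENNReal.toReal_nonneg (a := eLpNorm h (ENNReal.ofReal m) volume)).eq_or_lt with h0 | hApos
  · have h1 : eLpNorm h (ENNReal.ofReal m) volume = 0 :=
      ((ENNReal.toReal_eq_zero_iff _).1 h0.symm).resolve_right hh.2.ne
    rw [eLpNorm_eq_zero_iff hh.1 hp0] at h1
    have h2 : HasFourier f (fun _ => 0) := fun φ => by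
      refine ⟨by simp, ?_⟩
      rw [((hf.congr h1) φ).2]
      simp
    have h3 : ∫⁻ ξ in {ξ | rad ξ ≤ R}, ‖G ξ‖ₑ ^ 2 = 0 := by
      rw [lintegral_congr_ae (g := fun _ => 0), lintegral_zero]
      filter_upwards [ae_restrict_of_ae (hG.unique h2)] with ξ hξ
      rw [hξ]; simp
    rw [h3]
    exact zero_le
  change 0 < A at hApos
  have hP : ∫⁻ x, ENNReal.ofReal (‖h x‖ ^ m) = ENNReal.ofReal (A ^ m) := by
    have h1 := eLpNorm_eq_lintegral_rpow_enorm_toReal hp0 ENNReal.ofReal_ne_top (f := h)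
      (μ := volume)
    rw [ENNReal.toReal_ofReal hm0.le] at h1
    rw [← ENNReal.ofReal_rpow_of_pos hApos, hA, ENNReal.ofReal_toReal hh.2.ne, h1,
      ← ENNReal.rpow_mul, one_div, inv_mul_cancel₀ hm0.ne', ENNReal.rpow_one]
    congr 1
    ext x
    rw [← ofReal_norm, ENNReal.ofReal_rpow_of_nonneg (norm_nonneg _) hm0.le]
  set Λ := R ^ (3 / m) * A with hΛ
  have hΛ0 : 0 < Λ := by positivity
  have hmeas : AEStronglyMeasurable (fun x => truncate Λ (h x)) volume :=
    ((measurable_truncate Λ).comp_aemeasurable hh.1.aemeasurable).aestronglyMeasurable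
  have b₂ : ∫⁻ x, ‖truncate Λ (h x)‖ₑ ^ 2 ≤ ENNReal.ofReal (Λ ^ (2 - m) * A ^ m) := by
    rw [ENNReal.ofReal_mul (by positivity), ← hP, ← lintegral_const_mul' _ _ ENNReal.ofReal_ne_top]
    exact lintegral_mono fun x => enorm_truncate_sq_le hΛ0 hm₂ _
  have b₁ : ∫⁻ x, ‖h x - truncate Λ (h x)‖ₑ ≤ ENNReal.ofReal (Λ ^ (1 - m) * A ^ m) := by
    rw [ENNReal.ofReal_mul (by positivity), ← hP, ← lintegral_const_mul' _ _ ENNReal.ofReal_ne_top]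
    exact lintegral_mono fun x => enorm_sub_truncate_le hΛ0 hm₁ _
  have mem₂ : MemLp (fun x => truncate Λ (h x)) 2 volume := by
    refine ⟨hmeas, ?_⟩
    rw [eLpNorm_lt_top_iff_lintegral_rpow_enorm_lt_top two_ne_zero ENNReal.ofNat_ne_top]
    simpa using b₂.trans_lt ENNReal.ofReal_lt_top
  have int₁ : Integrable (fun x => h x - truncate Λ (h x)) volume :=
    ⟨hh.1.sub hmeas, b₁.trans_lt ENNReal.ofReal_lt_top⟩
  set g₂ : L2 := mem₂.toLp _ with hg₂
  have f₂ : IsFunction (ofL2 g₂) (fun x => truncate Λ (h x)) :=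
    (isFunction_ofL2 g₂).congr mem₂.coeFn_toLp
  have hG₁ := hasFourier_of_integrable (hf.sub f₂) int₁
  have hG₂ := hasFourier_ofL2 g₂
  have hsum := hG₁.add hG₂
  rw [sub_add_cancel] at hsum
  set F₁ := 𝓕 (fun x => h x - truncate Λ (h x)) with hF₁
  have hb₁ : ∀ ξ, ‖F₁ ξ‖ₑ ≤ ENNReal.ofReal (Λ ^ (1 - m) * A ^ m) := fun ξ => by
    rw [← ofReal_norm]
    refine (ENNReal.ofReal_le_ofReal (norm_fourier_le _ ξ)).trans ?_
    rw [ofReal_integral_norm_eq_lintegral_enorm int₁]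
    exact b₁
  have hb₂ : ∫⁻ ξ, ‖(𝓕 g₂ : L2) ξ‖ₑ ^ 2 ≤ ENNReal.ofReal (Λ ^ (2 - m) * A ^ m) := by
    rw [lintegral_enorm_sq_fourier]
    refine le_trans (le_of_eq (lintegral_congr_ae ?_)) b₂
    filter_upwards [mem₂.coeFn_toLp] with x hx
    rw [hg₂, hx]
  calc ∫⁻ ξ in {ξ | rad ξ ≤ R}, ‖G ξ‖ₑ ^ 2
      ≤ ∫⁻ ξ in {ξ | rad ξ ≤ R}, (2 * ENNReal.ofReal (Λ ^ (1 - m) * A ^ m) ^ 2 +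
          2 * ‖(𝓕 g₂ : L2) ξ‖ₑ ^ 2) := by
        refine lintegral_mono_ae ?_
        filter_upwards [ae_restrict_of_ae (hG.unique hsum)] with ξ hξ
        rw [hξ]
        refine (enorm_add_sq_le _ _).trans ?_
        gcongr
        exact hb₁ ξ
    _ ≤ 2 * ENNReal.ofReal (Λ ^ (1 - m) * A ^ m) ^ 2 * volume {ξ | rad ξ ≤ R} +
          2 * ENNReal.ofReal (Λ ^ (2 - m) * A ^ m) := by
        rw [lintegral_add_left measurable_const, setLIntegral_const,
          lintegral_const_mul' _ _ ENNReal.ofNat_ne_top]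
        gcongr
        exact (setLIntegral_le_lintegral _ _).trans hb₂
    _ = _ := by
        rw [volume_rad_le hR]
        have e1 : (Λ ^ (1 - m) * A ^ m) ^ 2 * R ^ 3 = R ^ (3 * (2 - m) / m) * A ^ 2 := by
          have a1 : A ^ (1 - m) * A ^ m = A := by rw [← Real.rpow_add hApos]; simp
          have a2 : (R ^ (3 / m * (1 - m))) ^ 2 * R ^ 3 = R ^ (3 * (2 - m) / m) := by
            rw [← Real.rpow_natCast, ← Real.rpow_natCast, ← Real.rpow_mul hR.le,
              ← Real.rpow_add hR]
            congr 1
            push_cast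
            field_simp
            ring
          rw [hΛ, Real.mul_rpow (by positivity) hApos.le, ← Real.rpow_mul hR.le, mul_assoc, a1,
            mul_pow, mul_right_comm, a2]
        have e2 : Λ ^ (2 - m) * A ^ m = R ^ (3 * (2 - m) / m) * A ^ 2 := by
          have a1 : A ^ (2 - m) * A ^ m = A ^ 2 := by
            rw [← Real.rpow_add hApos, ← Real.rpow_natCast]; norm_num
          rw [hΛ, Real.mul_rpow (by positivity) hApos.le, ← Real.rpow_mul hR.le, mul_assoc, a1]
          congr 2
          field_simp
        have e3 : ENNReal.ofReal (Λ ^ (1 - m) * A ^ m) ^ 2 * ENNReal.ofReal (R ^ 3) =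
            ENNReal.ofReal (R ^ (3 * (2 - m) / m) * A ^ 2) := by
          rw [← ENNReal.ofReal_pow (by positivity), ← ENNReal.ofReal_mul (by positivity), e1]
        rw [e2, mul_assoc, ← mul_assoc (ENNReal.ofReal _ ^ 2), e3, mul_assoc _ (R ^ _),
          ENNReal.ofReal_mul (p := 2 * ν.toReal + 2) (by positivity), ENNReal.ofReal_add (by positivity) (by positivity),
          ENNReal.ofReal_mul zero_le_two, ENNReal.ofReal_toReal hν1, ENNReal.ofReal_ofNat]
        ring

/-! ### Decay of weighted norms in frequency space -/

/-- Each point `r` of the weight is dominated by an integral over `[r, 2r]`, which turns a bound for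
the mass of the balls `{rad ≤ R}` into a bound for a weighted norm. -/
theorem rpow_mul_exp_le_lintegral {σ p c t : ℝ} (hp : 0 < p) (hc : 0 < c) (ht : 0 ≤ t) {r : ℝ}
    (hr : 0 < r) : ENNReal.ofReal (r ^ (2 * σ) * Real.exp (-(c * r ^ p * t))) ≤
      ENNReal.ofReal (max 1 (2 ^ (1 - 2 * σ))) * ∫⁻ R in Set.Ioc r (2 * r),
        ENNReal.ofReal (R ^ (2 * σ - 1) * Real.exp (-(c / 2 ^ p * t * R ^ p))) := by
  set K : ℝ := max 1 (2 ^ (1 - 2 * σ)) with hK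
  have hK0 : 0 < K := lt_max_of_lt_left one_pos
  have hlow : ∀ R ∈ Set.Ioc r (2 * r),
      ENNReal.ofReal (K⁻¹ * r ^ (2 * σ - 1) * Real.exp (-(c * r ^ p * t))) ≤
        ENNReal.ofReal (R ^ (2 * σ - 1) * Real.exp (-(c / 2 ^ p * t * R ^ p))) := by
    rintro R ⟨h1, h2⟩
    apply ENNReal.ofReal_le_ofReal
    have hR : 0 < R := hr.trans h1
    have e1 : c / 2 ^ p * t * R ^ p ≤ c * r ^ p * t := by
      calc c / 2 ^ p * t * R ^ p ≤ c / 2 ^ p * t * (2 * r) ^ p := by gcongr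
        _ = c * r ^ p * t := by
          rw [Real.mul_rpow (by norm_num) hr.le]
          field_simp
    have e2 : r ^ (2 * σ - 1) ≤ K * R ^ (2 * σ - 1) := by
      rcases le_total 0 (2 * σ - 1) with h | h
      · calc r ^ (2 * σ - 1) ≤ 1 * R ^ (2 * σ - 1) := by rw [one_mul]; gcongr
          _ ≤ K * R ^ (2 * σ - 1) := by gcongr; exact le_max_left _ _
      · have h3 : (2 * r) ^ (2 * σ - 1) ≤ R ^ (2 * σ - 1) := Real.rpow_le_rpow_of_nonpos hR h2 h
        have h4 : r ^ (2 * σ - 1) = 2 ^ (1 - 2 * σ) * (2 * r) ^ (2 * σ - 1) := by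
          rw [Real.mul_rpow (by norm_num) hr.le, ← mul_assoc, ← Real.rpow_add (by norm_num)]
          simp
        rw [h4]
        gcongr
        exact le_max_right _ _
    have e3 : K⁻¹ * r ^ (2 * σ - 1) ≤ R ^ (2 * σ - 1) := by
      rwa [inv_mul_le_iff₀ hK0]
    gcongr
  have h1 := setLIntegral_mono' (μ := volume) measurableSet_Ioc hlow
  rw [setLIntegral_const, Real.volume_Ioc] at h1
  refine le_trans (le_of_eq ?_) (mul_le_mul_right h1 _)
  rw [← ENNReal.ofReal_mul (by positivity), ← ENNReal.ofReal_mul hK0.le]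
  congr 1
  have : r ^ (2 * σ - 1) * r = r ^ (2 * σ) := by
    rw [← Real.rpow_add_one hr.ne']; norm_num
  rw [← this]
  field_simp
  ring

theorem exists_lintegral_weight_le {σ β p c : ℝ} (hp : 0 < p) (hc : 0 < c) (hσ : 0 < 2 * σ + β) :
    ∃ C : ℝ, 0 < C ∧ ∀ (G : R3 → ℂ) (A : ℝ), Measurable G → 0 ≤ A →
      (∀ R : ℝ, 0 < R → ∫⁻ ξ in {ξ | rad ξ ≤ R}, ‖G ξ‖ₑ ^ 2 ≤ ENNReal.ofReal (R ^ β * A)) →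
      ∀ t : ℝ, 0 < t → ∫⁻ ξ, ENNReal.ofReal (rad ξ ^ (2 * σ) * Real.exp (-(c * rad ξ ^ p * t))) *
        ‖G ξ‖ₑ ^ 2 ≤ ENNReal.ofReal (C * t ^ (-((2 * σ + β) / p)) * A) := by
  set K : ℝ := max 1 (2 ^ (1 - 2 * σ)) with hK
  have hK0 : 0 < K := lt_max_of_lt_left one_pos
  set c' := c / 2 ^ p with hc'
  have hc'0 : 0 < c' := by positivity
  have hΓ : 0 < Real.Gamma ((2 * σ + β) / p) := Real.Gamma_pos_of_pos (by positivity)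
  refine ⟨K * (c' ^ (-((2 * σ + β) / p)) * (1 / p) * Real.Gamma ((2 * σ + β) / p)), by positivity,
    fun G A hG hA h t ht => ?_⟩
  set w : ℝ → ℝ≥0∞ := fun R =>
    ENNReal.ofReal (R ^ (2 * σ - 1) * Real.exp (-(c' * t * R ^ p))) with hw
  have hwm : Measurable w := by
    refine ENNReal.measurable_ofReal.comp ?_
    fun_prop
  set S : Set (R3 × ℝ) := {x | rad x.1 ≤ x.2} with hS
  have hSm : MeasurableSet S := measurableSet_le (measurable_rad.comp measurable_fst) measurable_snd
  set Φ : R3 → ℝ → ℝ≥0∞ := fun ξ R => S.indicator (fun x => w x.2 * ‖G x.1‖ₑ ^ 2) (ξ, R) with hΦ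
  have hΦm : Measurable (Function.uncurry Φ) :=
    ((hwm.comp measurable_snd).mul ((hG.comp measurable_fst).enorm.pow_const 2)).indicator hSm
  have hGamma : ∫⁻ R in Set.Ioi (0 : ℝ), w R * ENNReal.ofReal (R ^ β * A) = ENNReal.ofReal
      (t ^ (-((2 * σ + β) / p)) *
        (c' ^ (-((2 * σ + β) / p)) * (1 / p) * Real.Gamma ((2 * σ + β) / p)) * A) := by
    have hq : -1 < 2 * σ + β - 1 := by linarith
    have hi := integral_rpow_mul_exp_neg_mul_rpow hp hq (mul_pos hc'0 ht)
    have hint := integrableOn_rpow_mul_exp_neg_mul_rpow hq hp (mul_pos hc'0 ht)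
    have e1 : ∀ R ∈ Set.Ioi (0 : ℝ), w R * ENNReal.ofReal (R ^ β * A) = ENNReal.ofReal
        (R ^ (2 * σ + β - 1) * Real.exp (-(c' * t) * R ^ p)) * ENNReal.ofReal A := by
      intro R hR
      have hR' : 0 < R := hR
      rw [hw, ← ENNReal.ofReal_mul (by positivity), ← ENNReal.ofReal_mul (by positivity)]
      congr 1
      rw [show 2 * σ + β - 1 = (2 * σ - 1) + β by ring, Real.rpow_add hR', neg_mul]
      ring
    rw [setLIntegral_congr_fun measurableSet_Ioi e1, lintegral_mul_const' _ _ ENNReal.ofReal_ne_top,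
      ← ofReal_integral_eq_lintegral_ofReal hint, hi, ← ENNReal.ofReal_mul]
    · congr 1
      rw [sub_add_cancel, Real.mul_rpow hc'0.le ht.le, neg_div]
      ring
    · rw [sub_add_cancel]
      positivity
    · filter_upwards [ae_restrict_mem measurableSet_Ioi] with R hR
      have hR' : 0 < R := hR
      positivity
  calc ∫⁻ ξ, ENNReal.ofReal (rad ξ ^ (2 * σ) * Real.exp (-(c * rad ξ ^ p * t))) * ‖G ξ‖ₑ ^ 2
      ≤ ∫⁻ ξ, ENNReal.ofReal K * ∫⁻ R in Set.Ioi (0 : ℝ), Φ ξ R := by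
        refine lintegral_mono_ae ?_
        filter_upwards [ae_ne_zero] with ξ hξ
        have hr := rad_pos hξ
        have h1 := rpow_mul_exp_le_lintegral (σ := σ) hp hc ht.le hr
        refine (mul_le_mul_left h1 _).trans ?_
        rw [mul_assoc, ← lintegral_mul_const' _ _ (by simp)]
        refine mul_le_mul_right ?_ _
        refine (setLIntegral_mono' measurableSet_Ioc fun R hR => ?_).trans
          (lintegral_mono_set (t := Set.Ioi 0) fun R hR => hr.trans hR.1)
        have hmem : (ξ, R) ∈ S := hR.1.le
        simp only [hΦ, Set.indicator_of_mem hmem]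
        exact le_rfl
    _ = ENNReal.ofReal K * ∫⁻ R in Set.Ioi (0 : ℝ), ∫⁻ ξ, Φ ξ R := by
        rw [lintegral_const_mul' _ _ ENNReal.ofReal_ne_top,
          lintegral_lintegral_swap hΦm.aemeasurable]
    _ ≤ ENNReal.ofReal K * ∫⁻ R in Set.Ioi (0 : ℝ), w R * ENNReal.ofReal (R ^ β * A) := by
        refine mul_le_mul_right (setLIntegral_mono' measurableSet_Ioi fun R hR => ?_) _
        have hm : MeasurableSet {ξ : R3 | rad ξ ≤ R} := measurableSet_le measurable_rad
          measurable_const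
        have e : (fun ξ => Φ ξ R) =
            {ξ : R3 | rad ξ ≤ R}.indicator fun ξ => w R * ‖G ξ‖ₑ ^ 2 := by
          ext ξ
          by_cases hξ : rad ξ ≤ R
          · rw [Set.indicator_of_mem (show ξ ∈ {ξ : R3 | rad ξ ≤ R} from hξ)]
            exact Set.indicator_of_mem (show (ξ, R) ∈ S from hξ) _
          · rw [Set.indicator_of_notMem (show ξ ∉ {ξ : R3 | rad ξ ≤ R} from hξ)]
            exact Set.indicator_of_notMem (show (ξ, R) ∉ S from hξ) _
        rw [e, lintegral_indicator hm, lintegral_const_mul' _ _ ENNReal.ofReal_ne_top]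
        exact mul_le_mul_right (h R hR) _
    _ = _ := by
        rw [hGamma, ← ENNReal.ofReal_mul hK0.le]
        congr 1
        ring

theorem rate_of_le_one {θ r : ℝ} (hr : 0 < r) (h : r ≤ 1) :
    rate θ r = r ^ (2 * max (1 - θ) θ) := by
  rcases le_total (1 - θ) θ with h' | h'
  · rw [max_eq_right h', rate, min_eq_left]
    exact Real.rpow_le_rpow_of_exponent_ge hr h (by linarith)
  · rw [max_eq_left h', rate, min_eq_right, mul_sub, mul_one]
    exact Real.rpow_le_rpow_of_exponent_ge hr h (by linarith)

theorem one_le_rate {θ r : ℝ} (hθ₀ : 0 ≤ θ) (hθ₁ : θ ≤ 1) (h : 1 ≤ r) : 1 ≤ rate θ r :=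
  le_min (Real.one_le_rpow h (by linarith)) (Real.one_le_rpow h (by linarith))

theorem exp_neg_le_rpow {c γ : ℝ} (hc : 0 < c) (hγ : 0 < γ) :
    ∃ C : ℝ, 0 < C ∧ ∀ t : ℝ, 0 ≤ t → Real.exp (-(c * t)) ≤ C * (1 + t) ^ (-γ) := by
  refine ⟨(γ / c) ^ γ * Real.exp c, by positivity, fun t ht => ?_⟩
  have h1 : (1 + t) ≤ γ / c * Real.exp (c / γ * (1 + t)) := by
    have h2 := Real.add_one_le_exp (c / γ * (1 + t))
    calc 1 + t = γ / c * (c / γ * (1 + t)) := by field_simp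
      _ ≤ _ := by gcongr; linarith
  have h3 : (1 + t) ^ γ ≤ (γ / c) ^ γ * Real.exp (c * (1 + t)) := by
    refine (Real.rpow_le_rpow (by positivity) h1 hγ.le).trans (le_of_eq ?_)
    rw [Real.mul_rpow (by positivity) (Real.exp_pos _).le, ← Real.exp_mul]
    congr 2
    field_simp
  rw [Real.rpow_neg (by positivity), ← div_eq_mul_inv, le_div_iff₀ (by positivity), Real.exp_neg,
    inv_mul_le_iff₀ (Real.exp_pos _)]
  refine h3.trans (le_of_eq ?_)
  rw [mul_add, mul_one, Real.exp_add]
  ring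

theorem enorm_ofReal_mul_sq (x : ℝ) (z : ℂ) :
    ‖(x : ℂ) * z‖ₑ ^ 2 = ENNReal.ofReal (x ^ 2) * ‖z‖ₑ ^ 2 := by
  rw [enorm_mul, mul_pow, ← ofReal_norm (x : ℂ), ← ENNReal.ofReal_pow (norm_nonneg _),
    Complex.norm_real, Real.norm_eq_abs, sq_abs]

/-- Low frequencies decay polynomially, by the Bernstein inequality; high frequencies decay
exponentially. -/
theorem exists_weighted_decay {m θ c σ s : ℝ} (hm₁ : 1 ≤ m) (hm₂ : m < 2) (hθ₀ : 0 ≤ θ)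
    (hθ₁ : θ ≤ 1) (hc : 0 < c) (hs : 0 ≤ s) (hσs : σ ≤ s) (hσ : 0 < 2 * σ + 3 * (2 - m) / m) :
    ∃ C : ℝ, 0 < C ∧ ∀ (f : DistZ) (g : L2) (h : R3 → ℂ), HasFourier f (𝓕 g : L2) →
      IsFunction f h → MemLp h (ENNReal.ofReal m) volume → ∀ t : ℝ, 0 ≤ t →
      eLpNorm (fun ξ => ((rad ξ ^ σ * Real.exp (-(c * rate θ (rad ξ) * t)) : ℝ) : ℂ) *
        (𝓕 g : L2) ξ) 2 volume ≤
      ENNReal.ofReal (C * (1 + t) ^ (-((2 * σ + 3 * (2 - m) / m) / (4 * max (1 - θ) θ)))) *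
        (eLpNorm (fun ξ => (((1 + rad ξ ^ 2) ^ (s / 2) : ℝ) : ℂ) * (𝓕 g : L2) ξ) 2 volume +
          eLpNorm h (ENNReal.ofReal m) volume) := by
  set M := max (1 - θ) θ with hM
  have hM0 : 0 < M := by
    rcases le_total (1 - θ) θ with h | h
    · exact lt_max_of_lt_right (by linarith)
    · exact lt_max_of_lt_left (by linarith)
  set β := 3 * (2 - m) / m with hβ
  set γ := (2 * σ + β) / (4 * M) with hγ
  have hγ0 : 0 < γ := by positivity
  obtain ⟨C₀, hC₀, h₀⟩ := exists_lintegral_rad_le hm₁ hm₂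
  obtain ⟨C₁, hC₁, h₁⟩ := exists_lintegral_weight_le (σ := σ) (β := β) (p := 2 * M) (c := 2 * c)
    (by positivity) (by positivity) hσ
  obtain ⟨C₂, hC₂, h₂⟩ := exp_neg_le_rpow hc hγ0
  set C := √(Real.exp (2 * c) * (C₁ * C₀)) + C₂ with hC
  have hsq0 : 0 ≤ √(Real.exp (2 * c) * (C₁ * C₀)) := Real.sqrt_nonneg _
  have hCsq : Real.exp (2 * c) * (C₁ * C₀) ≤ C ^ 2 := by
    rw [← Real.sq_sqrt (by positivity : 0 ≤ Real.exp (2 * c) * (C₁ * C₀))]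
    gcongr
    linarith
  have hC₂C : C₂ ≤ C := by linarith
  refine ⟨C, by positivity, fun f g h hf hh hm t ht => ?_⟩
  set A := (eLpNorm h (ENNReal.ofReal m) volume).toReal with hA
  have hA0 : 0 ≤ A := ENNReal.toReal_nonneg
  set G : R3 → ℂ := ⇑(𝓕 g : L2) with hG
  set T := 1 + t with hT
  have hT0 : 0 < T := by positivity
  set N := eLpNorm (fun ξ => (((1 + rad ξ ^ 2) ^ (s / 2) : ℝ) : ℂ) * G ξ) 2 volume with hN
  have low := h₁ G (C₀ * A ^ 2) (Lp.stronglyMeasurable _).measurable (by positivity)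
    (fun R hR => (h₀ f G h hf hh hm R hR).trans (le_of_eq (by congr 1; ring))) T hT0
  have hpt : ∀ ξ : R3, ξ ≠ 0 → (rad ξ ^ σ * Real.exp (-(c * rate θ (rad ξ) * t))) ^ 2 ≤
      Real.exp (2 * c) *
        (rad ξ ^ (2 * σ) * Real.exp (-(2 * c * rad ξ ^ (2 * M) * T))) +
      Real.exp (-(c * t)) ^ 2 * ((1 + rad ξ ^ 2) ^ (s / 2)) ^ 2 := fun ξ hξ => by
    have hr := rad_pos hξ
    set r := rad ξ
    have e1 : (r ^ σ) ^ 2 = r ^ (2 * σ) := by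
      rw [← Real.rpow_natCast, ← Real.rpow_mul hr.le]; congr 1; push_cast; ring
    rcases le_total r 1 with hr1 | hr1
    · refine le_add_of_le_of_nonneg ?_ (by positivity)
      rw [mul_pow, e1, rate_of_le_one hr hr1, ← Real.exp_nat_mul, mul_left_comm, ← Real.exp_add]
      gcongr
      -- On `r ≤ 1` the time may be shifted by one at the cost of a constant.
      have h3 : r ^ (2 * M) ≤ 1 := Real.rpow_le_one hr.le hr1 (by positivity)
      rw [hT]
      push_cast
      nlinarith
    · refine le_add_of_nonneg_of_le (by positivity) ?_
      rw [mul_pow, mul_comm]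
      have h3 := one_le_rate hθ₀ hθ₁ hr1
      have h4 : c * t ≤ c * rate θ r * t := by
        have : c * 1 ≤ c * rate θ r := by gcongr
        nlinarith
      have h5 : r ^ σ ≤ (1 + r ^ 2) ^ (s / 2) := by
        calc r ^ σ ≤ r ^ s := Real.rpow_le_rpow_of_exponent_le hr1 hσs
          _ = (r ^ 2) ^ (s / 2) := by
            rw [← Real.rpow_natCast, ← Real.rpow_mul hr.le]; congr 1; push_cast; ring
          _ ≤ _ := by gcongr; linarith
      gcongr
  have hK : (ENNReal.ofReal (C * T ^ (-γ)) * (N + eLpNorm h (ENNReal.ofReal m) volume)) ^ 2 ≥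
      ENNReal.ofReal (Real.exp (2 * c)) *
        ENNReal.ofReal (C₁ * T ^ (-((2 * σ + β) / (2 * M))) * (C₀ * A ^ 2)) +
      ENNReal.ofReal (Real.exp (-(c * t)) ^ 2) * N ^ 2 := by
    have e1 : T ^ (-((2 * σ + β) / (2 * M))) = (T ^ (-γ)) ^ 2 := by
      rw [← Real.rpow_natCast, ← Real.rpow_mul hT0.le, hγ]
      congr 1
      push_cast
      field_simp
      ring
    have e2 : ENNReal.ofReal (Real.exp (2 * c)) *
        ENNReal.ofReal (C₁ * T ^ (-((2 * σ + β) / (2 * M))) * (C₀ * A ^ 2)) ≤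
        ENNReal.ofReal (C * T ^ (-γ)) ^ 2 * eLpNorm h (ENNReal.ofReal m) volume ^ 2 := by
      rw [← ENNReal.ofReal_toReal hm.2.ne, ← hA, ← ENNReal.ofReal_mul (by positivity),
        ← ENNReal.ofReal_pow (by positivity), ← ENNReal.ofReal_pow hA0,
        ← ENNReal.ofReal_mul (by positivity), e1]
      apply ENNReal.ofReal_le_ofReal
      calc Real.exp (2 * c) * (C₁ * (T ^ (-γ)) ^ 2 * (C₀ * A ^ 2))
          = Real.exp (2 * c) * (C₁ * C₀) * ((T ^ (-γ)) ^ 2 * A ^ 2) := by ring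
        _ ≤ C ^ 2 * ((T ^ (-γ)) ^ 2 * A ^ 2) := by gcongr
        _ = _ := by ring
    have e3 : ENNReal.ofReal (Real.exp (-(c * t)) ^ 2) ≤ ENNReal.ofReal (C * T ^ (-γ)) ^ 2 := by
      rw [← ENNReal.ofReal_pow (by positivity)]
      apply ENNReal.ofReal_le_ofReal
      gcongr
      exact (h₂ t ht).trans (by gcongr)
    calc _ ≤ ENNReal.ofReal (C * T ^ (-γ)) ^ 2 * eLpNorm h (ENNReal.ofReal m) volume ^ 2 +
          ENNReal.ofReal (C * T ^ (-γ)) ^ 2 * N ^ 2 := by gcongr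
      _ = ENNReal.ofReal (C * T ^ (-γ)) ^ 2 *
          (N ^ 2 + eLpNorm h (ENNReal.ofReal m) volume ^ 2) := by ring
      _ ≤ _ := by
        rw [mul_pow]
        gcongr
        exact pow_add_pow_le zero_le zero_le two_ne_zero
  rw [← ENNReal.pow_le_pow_left_iff two_ne_zero]
  refine le_trans ?_ hK
  rw [eLpNorm_two_sq]
  calc ∫⁻ ξ, ‖((rad ξ ^ σ * Real.exp (-(c * rate θ (rad ξ) * t)) : ℝ) : ℂ) * G ξ‖ₑ ^ 2
      ≤ ∫⁻ ξ, (ENNReal.ofReal (Real.exp (2 * c)) * (ENNReal.ofReal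
          (rad ξ ^ (2 * σ) * Real.exp (-(2 * c * rad ξ ^ (2 * M) * T))) * ‖G ξ‖ₑ ^ 2) +
          ENNReal.ofReal (Real.exp (-(c * t)) ^ 2) *
            ‖(((1 + rad ξ ^ 2) ^ (s / 2) : ℝ) : ℂ) * G ξ‖ₑ ^ 2) := by
        refine lintegral_mono_ae ?_
        filter_upwards [ae_ne_zero] with ξ hξ
        have hr := rad_nonneg ξ
        rw [enorm_ofReal_mul_sq, enorm_ofReal_mul_sq, ← mul_assoc, ← mul_assoc, ← add_mul,
          ← ENNReal.ofReal_mul (by positivity), ← ENNReal.ofReal_mul (by positivity),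
          ← ENNReal.ofReal_add (by positivity) (by positivity)]
        gcongr
        exact hpt ξ hξ
    _ ≤ _ := by
        rw [lintegral_add_right, lintegral_const_mul' _ _ ENNReal.ofReal_ne_top,
          lintegral_const_mul' _ _ ENNReal.ofReal_ne_top, ← eLpNorm_two_sq]
        · gcongr
        · have hGm : Measurable G := (Lp.stronglyMeasurable _).measurable
          have : Measurable fun ξ => (((1 + rad ξ ^ 2) ^ (s / 2) : ℝ) : ℂ) :=
            Complex.measurable_ofReal.comp
              (((measurable_rad.pow_const 2).const_add 1).pow_const (s / 2))
          exact ((this.mul hGm).enorm.pow_const 2).const_mul _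

/-! ### From frequency space to the solution -/

theorem le_mul_add_iInf {ι : Sort*} {X K N : ℝ≥0∞} {Y : ι → ℝ≥0∞} (hK₀ : K ≠ 0)
    (hK : K ≠ ⊤) (h : ∀ i, X ≤ K * (N + Y i)) : X ≤ K * (N + ⨅ i, Y i) := by
  rw [← ENNReal.div_le_iff' hK₀ hK, ← tsub_le_iff_left]
  refine le_iInf fun i => ?_
  rw [tsub_le_iff_left, ENNReal.div_le_iff' hK₀ hK]
  exact h i

/-- The infima that define the norms of the data are taken last, since the constant does not depend
on the representing functions. -/
theorem exists_data_decay {m θ c σ s : ℝ} (hm₁ : 1 ≤ m) (hm₂ : m < 2) (hθ₀ : 0 ≤ θ)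
    (hθ₁ : θ ≤ 1) (hc : 0 < c) (hs : 0 ≤ s) (hσs : σ ≤ s) (hσ : 0 < 2 * σ + 3 * (2 - m) / m) :
    ∃ C : ℝ, 0 < C ∧ ∀ (f : DistZ) (v w : L2), riesz 1 f = ofL2 v → ∀ t : ℝ, 0 ≤ t →
      eLpNorm (fun ξ => ((rad ξ ^ σ * Real.exp (-(c * rate θ (rad ξ) * t)) : ℝ) : ℂ) *
        (𝓕 v : L2) ξ) 2 volume +
      eLpNorm (fun ξ => ((rad ξ ^ σ * Real.exp (-(c * rate θ (rad ξ) * t)) : ℝ) : ℂ) *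
        (𝓕 w : L2) ξ) 2 volume ≤
      ENNReal.ofReal (C * (1 + t) ^ (-((2 * σ + 3 * (2 - m) / m) / (4 * max (1 - θ) θ)))) *
        normData m s f w := by
  obtain ⟨C, hC, h⟩ := exists_weighted_decay hm₁ hm₂ hθ₀ hθ₁ hc hs hσs hσ
  refine ⟨C, hC, fun f v w hf t ht => ?_⟩
  set K := ENNReal.ofReal
    (C * (1 + t) ^ (-((2 * σ + 3 * (2 - m) / m) / (4 * max (1 - θ) θ)))) with hK
  have hK0 : K ≠ 0 := by
    rw [hK, Ne, ENNReal.ofReal_eq_zero, not_le]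
    positivity
  have hv : eLpNorm (fun ξ => ((rad ξ ^ σ * Real.exp (-(c * rate θ (rad ξ) * t)) : ℝ) : ℂ) *
      (𝓕 v : L2) ξ) 2 volume ≤ K * (normDInvH s f + normRieszPotential m f) := by
    refine le_mul_add_iInf hK0 ENNReal.ofReal_ne_top fun k => ?_
    refine le_mul_add_iInf hK0 ENNReal.ofReal_ne_top fun hk => ?_
    refine le_mul_add_iInf hK0 ENNReal.ofReal_ne_top fun hfk => ?_
    rw [hf] at hfk
    refine (h (ofL2 v) v k (hasFourier_ofL2 v) hfk hk t ht).trans ?_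
    gcongr
    exact le_normDInvH s hf
  have hw : eLpNorm (fun ξ => ((rad ξ ^ σ * Real.exp (-(c * rate θ (rad ξ) * t)) : ℝ) : ℂ) *
      (𝓕 w : L2) ξ) 2 volume ≤ K * (normH s w + eLpNorm w (ENNReal.ofReal m) volume) := by
    rcases eq_or_ne (eLpNorm w (ENNReal.ofReal m) volume) ⊤ with h' | h'
    · rw [h', add_top, ENNReal.mul_top hK0]
      exact le_top
    · exact h (ofL2 w) w w (hasFourier_ofL2 w) (isFunction_ofL2 w)
        ⟨Lp.aestronglyMeasurable w, lt_top_iff_ne_top.2 h'⟩ t ht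
  refine (add_le_add hv hw).trans (le_of_eq ?_)
  rw [normData]
  ring

/-- Both estimates at once: `σ = s` controls the derivatives, `σ = -1` and `s = 0` the solution
itself. -/
theorem exists_solution_norm_le {a b m θ σ s : ℝ} (ha : 0 < a ^ 2) (hb : 0 < b ^ 2)
    (hm₁ : 1 ≤ m) (hm₂ : m < 2) (hθ₀ : 0 ≤ θ) (hθ₁ : θ ≤ 1) (hs : 0 ≤ s) (hσs : σ ≤ s)
    (hσ : 0 < 2 * σ + 3 * (2 - m) / m) :
    ∃ C : ℝ, 0 < C ∧ ∀ (u₀ : Fin 3 → DistZ) (u₁ : Fin 3 → L2) (u : ℝ → Fin 3 → DistZ)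
      (ut : ℝ → Fin 3 → L2), IsEnergySolution a b θ u₀ u₁ u ut → ∀ t, 0 ≤ t → ∀ k,
      normLp 2 (riesz (σ + 1) (u t k)) ≤
        ENNReal.ofReal (C * (1 + t) ^ (-((2 * σ + 3 * (2 - m) / m) / (4 * max (1 - θ) θ)))) *
          ∑ j, normData m s (u₀ j) (u₁ j) ∧
      normLp 2 (riesz σ (ofL2 (ut t k))) ≤
        ENNReal.ofReal (C * (1 + t) ^ (-((2 * σ + 3 * (2 - m) / m) / (4 * max (1 - θ) θ)))) *
          ∑ j, normData m s (u₀ j) (u₁ j) := by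
  obtain ⟨C₁, c, hC₁, hc, h₁⟩ := exists_solution_decay ha hb hθ₀
  obtain ⟨C₂, hC₂, h₂⟩ := exists_data_decay hm₁ hm₂ hθ₀ hθ₁ hc hs hσs hσ
  refine ⟨C₁ * C₂, by positivity, fun u₀ u₁ u ut h t ht k => ?_⟩
  obtain ⟨v, hv⟩ := h.continuousOn_abs_D
  have hp := h₁ u₀ u₁ u ut h v (fun k => (hv k).1) (fun k => (hv k).2) t ht k
  set γ := (2 * σ + 3 * (2 - m) / m) / (4 * max (1 - θ) θ)
  set μ : R3 → ℝ := fun ξ => rad ξ ^ σ * Real.exp (-(c * rate θ (rad ξ) * t)) with hμ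
  have hμ0 : ∀ ξ, 0 ≤ μ ξ := fun ξ =>
    mul_nonneg (Real.rpow_nonneg (rad_nonneg ξ) _) (Real.exp_pos _).le
  have hμm : Measurable μ := (measurable_rad.pow_const σ).mul
    (((measurable_rate θ).const_mul c).mul_const t).neg.exp
  -- The dominating function, and its norm.
  set Φ : R3 → ℝ := fun ξ => C₁ * ∑ j, (‖(μ ξ : ℂ) * (𝓕 (v 0 j) : L2) ξ‖ +
    ‖(μ ξ : ℂ) * (𝓕 (ut 0 j) : L2) ξ‖) with hΦ
  have hmeas : ∀ g : L2, AEStronglyMeasurable (fun ξ => ‖(μ ξ : ℂ) * (𝓕 g : L2) ξ‖) volume :=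
    fun g => ((Complex.measurable_ofReal.comp hμm).aestronglyMeasurable.mul
      (Lp.aestronglyMeasurable _)).norm
  have hΦle : eLpNorm Φ 2 volume ≤ ENNReal.ofReal (C₁ * C₂ * (1 + t) ^ (-γ)) *
      ∑ j, normData m s (u₀ j) (u₁ j) := by
    have e : Φ = C₁ • ∑ j, fun ξ => (‖(μ ξ : ℂ) * (𝓕 (v 0 j) : L2) ξ‖ +
        ‖(μ ξ : ℂ) * (𝓕 (ut 0 j) : L2) ξ‖) := by
      ext ξ
      simp [hΦ, Finset.sum_apply]
    rw [e, eLpNorm_const_smul, mul_assoc, ENNReal.ofReal_mul hC₁.le, mul_assoc,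
      ← ofReal_norm C₁, Real.norm_of_nonneg hC₁.le]
    gcongr
    refine (eLpNorm_sum_le (fun j _ => (hmeas _).add (hmeas _)) one_le_two).trans ?_
    rw [Finset.mul_sum]
    refine Finset.sum_le_sum fun j _ => ?_
    refine (eLpNorm_add_le (hmeas _) (hmeas _) one_le_two).trans ?_
    rw [eLpNorm_norm, eLpNorm_norm, ← h.initial_u, ← h.initial_ut]
    exact h₂ (u 0 j) (v 0 j) (ut 0 j) ((hv j).2 0 le_rfl) t ht
  have hdom : ∀ ξ (z : ℂ), ‖z‖ ≤ C₁ * Real.exp (-(c * rate θ (rad ξ) * t)) *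
        ∑ j, (‖(𝓕 (v 0 j) : L2) ξ‖ + ‖(𝓕 (ut 0 j) : L2) ξ‖) →
      ‖((rad ξ ^ σ : ℝ) : ℂ) * z‖ ≤ Φ ξ := fun ξ z hz => by
    have hr : 0 ≤ rad ξ ^ σ := Real.rpow_nonneg (rad_nonneg ξ) _
    rw [norm_mul, Complex.norm_real, Real.norm_of_nonneg hr]
    refine (mul_le_mul_of_nonneg_left hz hr).trans (le_of_eq ?_)
    simp only [hΦ, norm_mul, Complex.norm_real, Real.norm_of_nonneg (hμ0 ξ), ← mul_add,
      ← Finset.mul_sum]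
    simp only [hμ]
    ring
  have e : riesz (σ + 1) (u t k) = riesz σ (ofL2 (v t k)) := by
    rw [← (hv k).2 t ht, riesz_riesz, add_comm]
  constructor
  · rw [e]
    refine (normLp_two_riesz_le σ _).trans (le_trans (eLpNorm_mono_ae_real ?_) hΦle)
    filter_upwards [hp] with ξ hξ
    exact hdom ξ _ hξ.1
  · refine (normLp_two_riesz_le σ _).trans (le_trans (eLpNorm_mono_ae_real ?_) hΦle)
    filter_upwards [hp] with ξ hξ
    exact hdom ξ _ hξ.2

end ElasticWave

theorem mainTheorem10 (a b θ s m : ℝ) (ha : 0 < a ^ 2) (hab : a ^ 2 < b ^ 2)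
    (hθ₀ : 0 ≤ θ) (hθ₁ : θ ≤ 1) (hs : 0 ≤ s) (hm₁ : 1 ≤ m) (hm₂ : m < 2) :
    ∃ C : ℝ, 0 < C ∧
      ∀ (u₀ : Fin 3 → DistZ) (u₁ : Fin 3 → L2), (∀ k, normData m s (u₀ k) (u₁ k) < (⊤ : ENNReal)) →
      ∀ (u : ℝ → Fin 3 → DistZ) (ut : ℝ → Fin 3 → L2), IsEnergySolution a b θ u₀ u₁ u ut →
      ∀ t : ℝ, 0 ≤ t → ∀ k : Fin 3,
        (m < 6 / 5 →
          normLp 2 (u t k) ≤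
            ENNReal.ofReal (C * (1 + t) ^ (-((6 - 5 * m) / (4 * m * max (1 - θ) θ)))) *
              ∑ j, normData m 0 (u₀ j) (u₁ j)) ∧
        normLp 2 (riesz (s + 1) (u t k)) + normLp 2 (riesz s (ofL2 (ut t k))) ≤
          ENNReal.ofReal
              (C * (1 + t) ^ (-((3 * (2 - m) + 2 * m * s) / (4 * m * max (1 - θ) θ)))) *
            ∑ j, normData m s (u₀ j) (u₁ j) := by
  have hm0 : 0 < m := by linarith
  have hb : 0 < b ^ 2 := ha.trans hab
  have hpos : 0 < 2 * s + 3 * (2 - m) / m := by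
    have : 0 < 3 * (2 - m) / m := div_pos (by linarith) hm0
    linarith
  obtain ⟨C₁, hC₁, h₁⟩ := exists_solution_norm_le ha hb hm₁ hm₂ hθ₀ hθ₁ hs le_rfl hpos
  have hlow : ∃ C : ℝ, 0 < C ∧ (m < 6 / 5 → ∀ (u₀ : Fin 3 → DistZ) (u₁ : Fin 3 → L2)
      (u : ℝ → Fin 3 → DistZ) (ut : ℝ → Fin 3 → L2), IsEnergySolution a b θ u₀ u₁ u ut →
      ∀ t, 0 ≤ t → ∀ k, normLp 2 (u t k) ≤
        ENNReal.ofReal (C * (1 + t) ^ (-((6 - 5 * m) / (4 * m * max (1 - θ) θ)))) *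
          ∑ j, normData m 0 (u₀ j) (u₁ j)) := by
    by_cases hm : m < 6 / 5
    · -- The weight `|ξ|⁻¹` is admissible near the origin exactly for `m < 6 / 5`.
      have hpos' : 0 < 2 * (-1) + 3 * (2 - m) / m := by
        have : 2 < 3 * (2 - m) / m := by rw [lt_div_iff₀ hm0]; linarith
        linarith
      obtain ⟨C, hC, h⟩ := exists_solution_norm_le ha hb hm₁ hm₂ hθ₀ hθ₁ le_rfl
        (by norm_num : (-1 : ℝ) ≤ 0) hpos'
      refine ⟨C, hC, fun _ u₀ u₁ u ut hu t ht k => ?_⟩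
      have h' := (h u₀ u₁ u ut hu t ht k).1
      rw [neg_add_cancel, riesz_zero] at h'
      have e : (2 * (-1) + 3 * (2 - m) / m) / (4 * max (1 - θ) θ) =
          (6 - 5 * m) / (4 * m * max (1 - θ) θ) := by
        rw [show 2 * (-1) + 3 * (2 - m) / m = (6 - 5 * m) / m by field_simp; ring, div_div]
        congr 1
        ring
      rwa [e] at h'
    · exact ⟨1, one_pos, fun h => absurd h hm⟩
  obtain ⟨C₂, hC₂, h₂⟩ := hlow
  refine ⟨2 * C₁ + C₂, by positivity, fun u₀ u₁ _ u ut hu t ht k => ⟨fun hm => ?_, ?_⟩⟩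
  · refine (h₂ hm u₀ u₁ u ut hu t ht k).trans ?_
    gcongr
    linarith
  · obtain ⟨h, h'⟩ := h₁ u₀ u₁ u ut hu t ht k
    refine (add_le_add h h').trans ?_
    have e : (2 * s + 3 * (2 - m) / m) / (4 * max (1 - θ) θ) =
        (3 * (2 - m) + 2 * m * s) / (4 * m * max (1 - θ) θ) := by
      rw [show 2 * s + 3 * (2 - m) / m = (3 * (2 - m) + 2 * m * s) / m by field_simp; ring, div_div]
      congr 1
      ring
    rw [e, ← two_mul, ← mul_assoc, ← ENNReal.ofReal_ofNat 2, ← ENNReal.ofReal_mul zero_le_two,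
      ← mul_assoc]
    gcongr
    linarith
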